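/- A graph $G$ is *3ECTF* if it is finite, triangle-free and 3-existentially complete: for all $B\subseteq A\subseteq V(G)$ with $|A|\le 3$ and $B$ independent, there is a vertex $v\notin A$ that is adjacent to every vertex of $B$ and to no vertex of $A\setminus B$. A tournament is *shattered* if any three of its vertices are contained in a four-vertex set inducing a copy of $T_4$ or of its reversal, where $T_4$ has vertices $0,1,2,3$ and arcs $0\to1$, $0\to2$, $0\to3$, $1\to2$, $2\to3$, $3\to1$. For $n\ge 2$ and $x\in\mathbb Z_2^n$ put $\tau(x_1,x_2,x_3,\dots,x_n)=(x_2,x_1+1,x_3,\dots,x_n)$, and let $d$ be the Hamming distance. For a tournament $T$ and positive integers $m,k$, the graph $G_T(m,k)$ has vertices $(i,j,x)$ with $i\in V(T)$, $1\le j\le m$, $x\in\mathbb Z_2^{3k-1}$, and its edges are given by - $(i,j,x)\sim(i,j,x')$ if $d(x,x')\in\{2k-1,2k+1,2k+2,\dots,3k-1\}$; - $(i,j,x)\sim(i,j',x')$ if $j\ne j'$ and $d(x,x')\in\{2k,\dots,3k-1\}$; - $(i,j,x)\sim(i',j',x')$ if $i\to i'$ in $T$ and $d(x,\tau(x'))\in\{2k,\dots,3k-1\}$.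 **Statement.** There is an absolute constant $c>0$ such that for every $\mu\in\mathbb N$ there are an integer $k\ge1$ and an $n_0$ such that, with $M=\max\{\mu,2\}$, for every $n\ge n_0$ there are at least $$2^{\,c\,n^2/(M\log M)^3}$$ pairwise nonisomorphic 3ECTF graphs with at most $n$ vertices in which every two distinct nonadjacent vertices have at least $\mu$ common neighbours. Moreover, these graphs can all be taken of the form $G_T(2,k)$ with $T$ a shattered tournament. -/

import Mathlib

/-- `G` is `k`-existentially complete: for all `B ⊆ A` with `|A| ≤ k` and `B` independent, there is
an additional vertex (outside `A`) adjacent to every vertex of `B` and to no vertex of `A \ B`. -/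
def IsExistentiallyComplete {V : Type*} (G : SimpleGraph V) (k : ℕ) : Prop :=
  ∀ A B : Finset V, B ⊆ A → A.card ≤ k → G.IsIndepSet (B : Set V) →
    ∃ v, v ∉ A ∧ (∀ b ∈ B, G.Adj v b) ∧ ∀ a ∈ A, a ∉ B → ¬ G.Adj v a

/-- A 3ECTF graph: finite, triangle-free and 3-existentially complete. -/
def Is3ECTF {V : Type*} (G : SimpleGraph V) : Prop :=
  Finite V ∧ G.CliqueFree 3 ∧ IsExistentiallyComplete G 3

/-- A tournament on `V`: an orientation of the complete graph on `V`. -/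
structure Tournament (V : Type*) where
  /-- `arc i j` means `i → j`. -/
  arc : V → V → Prop
  irrefl : ∀ i, ¬ arc i i
  asymm : ∀ i j, arc i j → ¬ arc j i
  total : ∀ i j, i ≠ j → arc i j ∨ arc j i

/-- The arcs of the tournament `T₄` on `{0, 1, 2, 3}`. -/
def T4Arc (u v : Fin 4) : Prop :=
  (u, v) ∈ ({(0, 1), (0, 2), (0, 3), (1, 2), (2, 3), (3, 1)} : Finset (Fin 4 × Fin 4))

/-- A tournament is shattered if every three of its vertices extend to a copy of `T₄` or of the
tournament obtained from `T₄` by reversing all arcs. -/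
def Tournament.IsShattered {V : Type*} (T : Tournament V) : Prop :=
  ∀ a b c : V, a ≠ b → a ≠ c → b ≠ c →
    ∃ f : Fin 4 ↪ V, a ∈ Set.range f ∧ b ∈ Set.range f ∧ c ∈ Set.range f ∧
      ((∀ u v, T.arc (f u) (f v) ↔ T4Arc u v) ∨ (∀ u v, T.arc (f u) (f v) ↔ T4Arc v u))

/-- The twist `τ(x₁, x₂, x₃, …, xₙ) = (x₂, x₁ + 1, x₃, …, xₙ)` of the hypercube `(ℤ/2)ⁿ`, `n ≥ 2`. -/
def twist {n : ℕ} (hn : 2 ≤ n) (x : Fin n → ZMod 2) : Fin n → ZMod 2 := fun i =>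
  if i.val = 0 then x ⟨1, by omega⟩
  else if i.val = 1 then x ⟨0, by omega⟩ + 1
  else x i

/-- The graph `G_T(m, k)`, `k ≥ 1`, on the triples `(i, j, x)` with `i` a vertex of `T`,
`j` one of `m` indices and `x ∈ (ℤ/2)^(3k-1)`; adjacency is the symmetric closure of the relation
given here. -/
def twistedGraph {V : Type*} (T : Tournament V) (m k : ℕ) (hk : 1 ≤ k) :
    SimpleGraph (V × Fin m × (Fin (3 * k - 1) → ZMod 2)) :=
  SimpleGraph.fromRel fun p q =>
    (p.1 = q.1 ∧ p.2.1 = q.2.1 ∧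
      (hammingDist p.2.2 q.2.2 = 2 * k - 1 ∨
        hammingDist p.2.2 q.2.2 ∈ Finset.Icc (2 * k + 1) (3 * k - 1))) ∨
    (p.1 = q.1 ∧ p.2.1 ≠ q.2.1 ∧ hammingDist p.2.2 q.2.2 ∈ Finset.Icc (2 * k) (3 * k - 1)) ∨
    (T.arc p.1 q.1 ∧
      hammingDist p.2.2 (twist (by omega) q.2.2) ∈ Finset.Icc (2 * k) (3 * k - 1))

/-!
On the first two coordinates the twist `τ` is a quarter turn of a 4-cycle, so that an arc of `T`
carries a sign in `ℤ/4`, and every tournament vertex `w` provides a common frame in which all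
vertices of `G_T(m, k)` are compared by Hamming distance in one cube of dimension `3k - 1`. Two
vertices are adjacent roughly when their distance is at least `2k`. Three pairwise distances in a
frame have an even sum of at most `6k - 2`, which excludes triangles. Three pairwise nonadjacent
vertices have a common neighbour if their distances are less than `2k - 1` in some frame, since the
antipode of a centre of the three points is far from all of them; when they lie over different
vertices of `T`, that triangle becomes cyclic when seen from the fourth vertex of a copy of `T₄` or
of its reversal, and one of the four frames then works.

For the count, reorienting the edges from a given vertex to a given triple completes a copy of `T₄`,
so a random tournament fails to do so at that vertex with probability at most `7/8`, independently
of the other vertices; hence almost all tournaments are shattered. The `n!` relabellings of the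
resulting graphs are negligible against the `2 ^ (t choose 2)` tournaments on `t` vertices.
-/

section Hamming

open Finset

variable {ι : Type*} [Fintype ι]

/-- The vertex of the cube `(ℤ/2)^ι` obtained from `x` by changing the coordinates in `S`. -/
def cubeFlip [DecidableEq ι] (x : ι → ZMod 2) (S : Finset ι) : ι → ZMod 2 := fun i =>
  if i ∈ S then x i + 1 else x i

/-- The set of coordinates in which two vertices of the cube differ; its cardinality is their
Hamming distance by definition. -/
def cubeDiff (x y : ι → ZMod 2) : Finset ι := {i | x i ≠ y i}

theorem mem_cubeDiff {x y : ι → ZMod 2} {i : ι} : i ∈ cubeDiff x y ↔ x i ≠ y i := by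
  simp [cubeDiff]

theorem card_cubeDiff (x y : ι → ZMod 2) : #(cubeDiff x y) = hammingDist x y := rfl

theorem hammingDist_add_one (x y : ι → ZMod 2) :
    hammingDist (x + 1) y + hammingDist x y = Fintype.card ι := by
  have flip_ne_iff : ∀ a b : ZMod 2, a + 1 ≠ b ↔ ¬ a ≠ b := by decide
  simp only [hammingDist, Pi.add_apply, Pi.one_apply, flip_ne_iff]
  rw [add_comm, card_filter_add_card_filter_not, card_univ]

theorem cubeFlip_injective {ι : Type*} [DecidableEq ι] (x : ι → ZMod 2) :
    Function.Injective (cubeFlip x) := by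
  intro S S' h
  ext i
  have hi := congrFun h i
  simp only [cubeFlip] at hi
  by_cases hS : i ∈ S <;> by_cases hS' : i ∈ S' <;> simp_all

theorem hammingDist_cubeFlip [DecidableEq ι] (x y : ι → ZMod 2) (S : Finset ι) :
    hammingDist (cubeFlip x S) y + 2 * #(S ∩ cubeDiff x y) = hammingDist x y + #S := by
  have flip_ne_iff : ∀ a b : ZMod 2, a + 1 ≠ b ↔ ¬ a ≠ b := by decide
  have diff_flip : cubeDiff (cubeFlip x S) y = symmDiff (cubeDiff x y) S := by
    ext i
    by_cases hi : i ∈ S <;> simp [mem_cubeDiff, cubeFlip, mem_symmDiff, hi, flip_ne_iff]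
  have h₁ := card_sdiff_add_card_inter (cubeDiff x y) S
  have h₂ := card_sdiff_add_card_inter S (cubeDiff x y)
  rw [← card_cubeDiff, diff_flip, ← card_cubeDiff, symmDiff_def, sup_eq_union,
    card_union_of_disjoint disjoint_sdiff_sdiff]
  rw [inter_comm] at h₁
  omega

theorem hammingDist_cubeFlip_self [DecidableEq ι] (x : ι → ZMod 2) (S : Finset ι) :
    hammingDist (cubeFlip x S) x = #S := by
  simpa [cubeDiff] using hammingDist_cubeFlip x x S

theorem exists_finset_card_inter_eq [DecidableEq ι] (D E : Finset ι) {s₀ s₁ s₂ s₃ : ℕ}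
    (h₀ : s₀ ≤ #(D ∪ E)ᶜ) (h₁ : s₁ ≤ #(D ∩ E)) (h₂ : s₂ ≤ #(D \ E)) (h₃ : s₃ ≤ #(E \ D)) :
    ∃ S : Finset ι, #S = s₀ + s₁ + s₂ + s₃ ∧ #(S ∩ D) = s₁ + s₂ ∧ #(S ∩ E) = s₁ + s₃ := by
  obtain ⟨S₀, hS₀, rfl⟩ := exists_subset_card_eq h₀
  obtain ⟨S₁, hS₁, rfl⟩ := exists_subset_card_eq h₁
  obtain ⟨S₂, hS₂, rfl⟩ := exists_subset_card_eq h₂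
  obtain ⟨S₃, hS₃, rfl⟩ := exists_subset_card_eq h₃
  simp only [subset_iff, mem_compl, mem_union, mem_inter, mem_sdiff] at hS₀ hS₁ hS₂ hS₃
  have inter_left : (S₀ ∪ S₁ ∪ S₂ ∪ S₃) ∩ D = S₁ ∪ S₂ := by
    ext i
    simp only [mem_inter, mem_union]
    grind
  have inter_right : (S₀ ∪ S₁ ∪ S₂ ∪ S₃) ∩ E = S₁ ∪ S₃ := by
    ext i
    simp only [mem_inter, mem_union]
    grind
  have disj₁₂ : Disjoint S₁ S₂ := disjoint_left.2 fun i => by grind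
  have disj₁₃ : Disjoint S₁ S₃ := disjoint_left.2 fun i => by grind
  have disj₀ : Disjoint S₀ S₁ := disjoint_left.2 fun i => by grind
  have disj₂ : Disjoint (S₀ ∪ S₁) S₂ := disjoint_left.2 fun i => by grind
  have disj₃ : Disjoint (S₀ ∪ S₁ ∪ S₂) S₃ := disjoint_left.2 fun i => by grind
  refine ⟨S₀ ∪ S₁ ∪ S₂ ∪ S₃, ?_, ?_, ?_⟩
  · rw [card_union_of_disjoint disj₃, card_union_of_disjoint disj₂, card_union_of_disjoint disj₀]
  · rw [inter_left, card_union_of_disjoint disj₁₂]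
  · rw [inter_right, card_union_of_disjoint disj₁₃]

/-- Here `p₀` counts the coordinates in which the three vertices agree, and `pᵢ` those in which the
`i`-th is the odd one out; `sᵢ` of the coordinates counted by `pᵢ` are changed in `y₁`. -/
theorem exists_hammingDist_eq (y₁ y₂ y₃ : ι → ZMod 2) :
    ∃ p₀ p₁ p₂ p₃ : ℕ, p₀ + p₁ + p₂ + p₃ = Fintype.card ι ∧ hammingDist y₁ y₂ = p₁ + p₂ ∧
      hammingDist y₁ y₃ = p₁ + p₃ ∧ hammingDist y₂ y₃ = p₂ + p₃ ∧
      ∀ s₀ s₁ s₂ s₃, s₀ ≤ p₀ → s₁ ≤ p₁ → s₂ ≤ p₂ → s₃ ≤ p₃ →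
        ∃ u, hammingDist u y₁ = s₀ + s₁ + s₂ + s₃ ∧
          hammingDist u y₂ + s₁ + s₂ = p₁ + p₂ + s₀ + s₃ ∧
          hammingDist u y₃ + s₁ + s₃ = p₁ + p₃ + s₀ + s₂ := by
  classical
  set D := cubeDiff y₁ y₂ with hD
  set E := cubeDiff y₁ y₃ with hE
  have hDE : cubeDiff y₂ y₃ = (D \ E) ∪ (E \ D) := by
    have two_values : ∀ a b c : ZMod 2, b ≠ c ↔ a ≠ b ∧ ¬ a ≠ c ∨ a ≠ c ∧ ¬ a ≠ b := by decide
    ext i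
    simpa only [hD, hE, mem_union, mem_sdiff, mem_cubeDiff] using two_values _ _ _
  have h₁₂ : hammingDist y₁ y₂ = #(D ∩ E) + #(D \ E) := (card_inter_add_card_sdiff D E).symm
  have h₁₃ : hammingDist y₁ y₃ = #(D ∩ E) + #(E \ D) := by
    rw [inter_comm]
    exact (card_inter_add_card_sdiff E D).symm
  have h₂₃ : hammingDist y₂ y₃ = #(D \ E) + #(E \ D) := by
    rw [← card_cubeDiff, hDE, card_union_of_disjoint disjoint_sdiff_sdiff]
  refine ⟨#(D ∪ E)ᶜ, #(D ∩ E), #(D \ E), #(E \ D), ?_, h₁₂, h₁₃, h₂₃,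
    fun s₀ s₁ s₂ s₃ hs₀ hs₁ hs₂ hs₃ => ?_⟩
  · have hD_card := card_inter_add_card_sdiff D E
    have hunion := card_union_add_card_inter D E
    have hE_card := card_inter_add_card_sdiff E D
    have hcompl := card_compl_add_card (D ∪ E)
    rw [inter_comm] at hE_card
    omega
  · obtain ⟨S, hS, hSD, hSE⟩ := exists_finset_card_inter_eq D E hs₀ hs₁ hs₂ hs₃
    have dist₂ := hammingDist_cubeFlip y₁ y₂ S
    have dist₃ := hammingDist_cubeFlip y₁ y₃ S
    rw [← hD] at dist₂
    rw [← hE] at dist₃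
    refine ⟨cubeFlip y₁ S, ?_, ?_, ?_⟩
    · rw [hammingDist_cubeFlip_self, hS]
    · omega
    · omega

theorem exists_hammingDist_add_eq_two_mul (y₁ y₂ y₃ : ι → ZMod 2) :
    ∃ m ≤ Fintype.card ι,
      hammingDist y₁ y₂ + hammingDist y₁ y₃ + hammingDist y₂ y₃ = 2 * m := by
  obtain ⟨p₀, p₁, p₂, p₃, hp, h₁₂, h₁₃, h₂₃, -⟩ := exists_hammingDist_eq y₁ y₂ y₃
  exact ⟨p₁ + p₂ + p₃, by omega, by omega⟩

theorem choose_le_card_hammingDist_eq [DecidableEq ι] (y₁ y₂ : ι → ZMod 2) {a b : ℕ}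
    (h : hammingDist y₁ y₂ = a + b) :
    (a + b).choose a ≤ #{u : ι → ZMod 2 | hammingDist u y₁ = a ∧ hammingDist u y₂ = b} := by
  rw [← h, ← card_cubeDiff, ← card_powersetCard]
  refine card_le_card_of_injOn (cubeFlip y₁) ?_ (cubeFlip_injective y₁).injOn
  intro S hS
  rw [mem_coe, mem_powersetCard] at hS
  have dist₁ := hammingDist_cubeFlip_self y₁ S
  have dist₂ := hammingDist_cubeFlip y₁ y₂ S
  rw [inter_eq_left.2 hS.1] at dist₂
  simp only [coe_filter, mem_univ, true_and, Set.mem_ofPred_eq]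
  omega

/-- Fix a `2r`-set `Z` containing all coordinates where `y₁` and `y₂` differ: of two complementary
`r`-subsets of `Z`, at least one moves `y₁` to within `r` of `y₂`. -/
theorem centralBinom_le_card_hammingDist_le [DecidableEq ι] {r : ℕ}
    (hr : 2 * r ≤ Fintype.card ι) (y₁ y₂ : ι → ZMod 2) (h : hammingDist y₁ y₂ ≤ 2 * r) :
    r.centralBinom ≤ 2 * #{u : ι → ZMod 2 | hammingDist u y₁ ≤ r ∧ hammingDist u y₂ ≤ r} := by
  obtain ⟨Z, hDZ, -, hZ⟩ := exists_subsuperset_card_eq (subset_univ (cubeDiff y₁ y₂)) h hr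
  set good := {S ∈ Z.powersetCard r | hammingDist (cubeFlip y₁ S) y₂ ≤ r}
  have covered : Z.powersetCard r ⊆ good ∪ good.image fun S => Z \ S := by
    intro S hS
    obtain ⟨hSZ, hSr⟩ := mem_powersetCard.1 hS
    have hcard := card_sdiff_of_subset hSZ
    rw [mem_union, mem_image]
    refine (le_or_gt (hammingDist (cubeFlip y₁ S) y₂) r).imp
      (fun hle => mem_filter.2 ⟨hS, hle⟩) fun hlt => ⟨Z \ S, mem_filter.2 ⟨?_, ?_⟩, ?_⟩
    · exact mem_powersetCard.2 ⟨sdiff_subset, by omega⟩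
    · have dist_S := hammingDist_cubeFlip y₁ y₂ S
      have dist_compl := hammingDist_cubeFlip y₁ y₂ (Z \ S)
      have hsplit : #(S ∩ cubeDiff y₁ y₂) + #((Z \ S) ∩ cubeDiff y₁ y₂) = hammingDist y₁ y₂ := by
        rw [← card_union_of_disjoint (disjoint_sdiff.mono inter_subset_left inter_subset_left),
          ← union_inter_distrib_right, union_sdiff_of_subset hSZ, inter_eq_right.2 hDZ,
          card_cubeDiff]
      omega
    · simp [inter_eq_right.2 hSZ]
  have good_le : #good ≤ #{u : ι → ZMod 2 | hammingDist u y₁ ≤ r ∧ hammingDist u y₂ ≤ r} := by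
    refine card_le_card_of_injOn (cubeFlip y₁) (fun S hS => ?_) (cubeFlip_injective y₁).injOn
    obtain ⟨hS, hle⟩ := mem_filter.1 hS
    simpa [hammingDist_cubeFlip_self, (mem_powersetCard.1 hS).2] using hle
  calc r.centralBinom = #(Z.powersetCard r) := by rw [card_powersetCard, hZ, Nat.centralBinom]
    _ ≤ #(good ∪ good.image fun S => Z \ S) := card_le_card covered
    _ ≤ #good + #(good.image fun S => Z \ S) := card_union_le _ _
    _ ≤ #good + #good := Nat.add_le_add_left card_image_le _
    _ ≤ _ := by omega

end Hamming

section HammingCenters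

variable {ι : Type*} [Fintype ι] {k : ℕ}

theorem exists_hammingDist_lt (y₁ y₂ y₃ : ι → ZMod 2) (h₁₂ : hammingDist y₁ y₂ + 2 ≤ 2 * k)
    (h₁₃ : hammingDist y₁ y₃ + 2 ≤ 2 * k) (h₂₃ : hammingDist y₂ y₃ + 2 ≤ 2 * k) :
    ∃ u, hammingDist u y₁ < k ∧ hammingDist u y₂ < k ∧ hammingDist u y₃ < k := by
  obtain ⟨p₀, p₁, p₂, p₃, hp, e₁₂, e₁₃, e₂₃, H⟩ := exists_hammingDist_eq y₁ y₂ y₃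
  obtain ⟨u, hu₁, hu₂, hu₃⟩ := H 0 (min p₁ (k - 1)) (p₂ - (k - 1)) (p₃ - (k - 1)) (by omega)
    (by omega) (by omega) (by omega)
  exact ⟨u, by omega, by omega, by omega⟩

theorem exists_hammingDist_eq_lt_lt (y₁ y₂ y₃ : ι → ZMod 2) (h₁₂ : hammingDist y₁ y₂ + 1 = 2 * k)
    (h₁₃ : hammingDist y₁ y₃ + 1 ≤ 2 * k) (h₂₃ : hammingDist y₂ y₃ + 2 ≤ 2 * k) :
    ∃ u, hammingDist u y₁ = k ∧ hammingDist u y₂ < k ∧ hammingDist u y₃ < k := by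
  obtain ⟨p₀, p₁, p₂, p₃, hp, e₁₂, e₁₃, e₂₃, H⟩ := exists_hammingDist_eq y₁ y₂ y₃
  obtain ⟨u, hu₁, hu₂, hu₃⟩ := H 0 (min k p₁) (k - p₁) 0 (by omega) (by omega) (by omega) (by omega)
  exact ⟨u, by omega, by omega, by omega⟩

theorem exists_hammingDist_eq_eq_max (y₁ y₂ y₃ : ι → ZMod 2) (h₁₂ : hammingDist y₁ y₂ = 2 * k) :
    ∃ u, hammingDist u y₁ = k ∧ hammingDist u y₂ = k ∧
      hammingDist u y₃ + k = max (hammingDist y₁ y₃) (hammingDist y₂ y₃) := by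
  obtain ⟨p₀, p₁, p₂, p₃, hp, e₁₂, e₁₃, e₂₃, H⟩ := exists_hammingDist_eq y₁ y₂ y₃
  obtain ⟨u, hu₁, hu₂, hu₃⟩ := H 0 (min k p₁) (k - p₁) 0 (by omega) (by omega) (by omega) (by omega)
  exact ⟨u, by omega, by omega, by omega⟩

theorem exists_hammingDist_lt_le (hk : 1 ≤ k) (hk' : Fintype.card ι + 1 = 3 * k)
    {y₁ y₂ : ι → ZMod 2} (h : y₁ ≠ y₂) : ∃ u, hammingDist u y₁ < k ∧ k ≤ hammingDist u y₂ := by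
  obtain ⟨p₀, p₁, p₂, p₃, hp, e₁₂, e₁₃, e₂₃, H⟩ := exists_hammingDist_eq y₁ y₂ y₂
  rw [hammingDist_self] at e₂₃
  rw [← hammingDist_pos] at h
  obtain ⟨u, hu₁, hu₂, -⟩ := H (min p₀ (k - 1)) 0 0 0 (by omega) (by omega) (by omega) (by omega)
  exact ⟨u, by omega, by omega⟩

theorem exists_le_hammingDist (hk : Fintype.card ι + 1 = 3 * k) (y₁ y₂ y₃ : ι → ZMod 2) :
    ∃ u, k ≤ hammingDist u y₁ ∧ k ≤ hammingDist u y₂ ∧ k ≤ hammingDist u y₃ := by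
  obtain ⟨p₀, p₁, p₂, p₃, hp, e₁₂, e₁₃, e₂₃, H⟩ := exists_hammingDist_eq y₁ y₂ y₃
  obtain ⟨u, hu₁, hu₂, hu₃⟩ := H p₀ (if 2 * k ≤ p₁ then p₁ / 2 else 0)
    (if 2 * k ≤ p₂ then p₂ / 2 else p₂) (if 2 * k ≤ p₃ then p₃ / 2 else p₃) le_rfl
    (by split_ifs <;> omega) (by split_ifs <;> omega) (by split_ifs <;> omega)
  refine ⟨u, ?_, ?_, ?_⟩ <;> split_ifs at hu₁ hu₂ hu₃ <;> omega

/-- Changing fewer than half of the coordinates in each of the regions counted by `p₁`, `p₂`, `p₃`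
brings `u` closer to `y₁` than to `y₂` and `y₃`. -/
theorem exists_hammingDist_eq_lt_hammingDist (hk : 7 ≤ k) (hk' : Fintype.card ι + 1 = 3 * k)
    (y₁ y₂ y₃ : ι → ZMod 2) :
    ∃ u, hammingDist u y₁ = k ∧ k ≤ hammingDist u y₂ ∧ k ≤ hammingDist u y₃ ∧
      (y₁ ≠ y₂ → k < hammingDist u y₂ ∧ hammingDist u y₂ < Fintype.card ι) ∧
      (y₁ ≠ y₃ → k < hammingDist u y₃ ∧ hammingDist u y₃ < Fintype.card ι) := by
  obtain ⟨p₀, p₁, p₂, p₃, hp, e₁₂, e₁₃, e₂₃, H⟩ := exists_hammingDist_eq y₁ y₂ y₃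
  rw [← hammingDist_pos, ← hammingDist_pos (x := y₁) (y := y₃), e₁₂, e₁₃]
  set s₁ := min k ((p₁ - 1) / 2)
  set s₂ := min (k - s₁) ((p₂ - 1) / 2)
  set s₃ := min (k - s₁ - s₂) ((p₃ - 1) / 2)
  obtain ⟨s₀, h₀, hs⟩ : ∃ s₀ ≤ p₀, s₀ + s₁ + s₂ + s₃ = k := ⟨k - s₁ - s₂ - s₃, by omega, by omega⟩
  have h₁ : 2 * s₁ ≤ p₁ - 1 := by omega
  have h₂ : 2 * s₂ ≤ p₂ - 1 := by omega
  have h₃ : 2 * s₃ ≤ p₃ - 1 := by omega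
  have move₂ : p₁ + p₂ + 1 = 2 * k → 1 ≤ s₁ + s₂ := by omega
  have move₃ : p₁ + p₃ + 1 = 2 * k → 1 ≤ s₁ + s₃ := by omega
  clear_value s₁ s₂ s₃
  obtain ⟨u, hu₁, hu₂, hu₃⟩ := H s₀ s₁ s₂ s₃ h₀ (by omega) (by omega) (by omega)
  clear H e₁₂ e₁₃ e₂₃
  exact ⟨u, by omega, by omega, by omega, fun _ => ⟨by omega, by omega⟩,
    fun _ => ⟨by omega, by omega⟩⟩

end HammingCenters

section Twist

/-- The position of the first two coordinates of `x` on the 4-cycle `00, 01, 11, 10`. The twist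
rotates this cycle by one step and the Hamming distance restricts to its graph distance. -/
def cubeAngle {n : ℕ} (hn : 2 ≤ n) (x : Fin n → ZMod 2) : ZMod 4 :=
  if x ⟨0, by omega⟩ = 0 then (if x ⟨1, by omega⟩ = 0 then 0 else 1)
  else if x ⟨1, by omega⟩ = 0 then 3 else 2

/-- The Hamming distance outside the first two coordinates. -/
def tailDist {n : ℕ} (x y : Fin n → ZMod 2) : ℕ :=
  Finset.card {i | 2 ≤ i.val ∧ x i ≠ y i}

/-- The distance to `0` in the 4-cycle `ℤ/4`. -/
def cycleNorm (s : ZMod 4) : ℕ := s.valMinAbs.natAbs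

variable {n : ℕ} (hn : 2 ≤ n)

theorem hammingDist_eq_cycleNorm_add_tailDist (x y : Fin n → ZMod 2) :
    hammingDist x y = cycleNorm (cubeAngle hn x - cubeAngle hn y) + tailDist x y := by
  obtain ⟨m, rfl⟩ : ∃ m, n = m + 2 := ⟨n - 2, by omega⟩
  have first_two : ∀ a b c d : ZMod 2,
      ((if a ≠ c then 1 else 0) + (if b ≠ d then 1 else 0) : ℕ) =
        cycleNorm ((if a = 0 then (if b = 0 then 0 else 1) else if b = 0 then 3 else 2) -
          (if c = 0 then (if d = 0 then 0 else 1) else if d = 0 then 3 else 2)) := by decide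
  have index_zero : (⟨0, by omega⟩ : Fin (m + 2)) = 0 := rfl
  have index_one : (⟨1, by omega⟩ : Fin (m + 2)) = Fin.succ 0 := rfl
  simp only [hammingDist, tailDist, Finset.card_filter, Fin.sum_univ_succ, cubeAngle, index_zero,
    index_one]
  rw [← add_assoc, first_two]
  simp

theorem cubeAngle_twist (x : Fin n → ZMod 2) :
    cubeAngle hn (twist hn x) = cubeAngle hn x + 1 := by
  have first_two : ∀ a b : ZMod 2,
      (if b = 0 then (if a + 1 = 0 then 0 else 1) else if a + 1 = 0 then 3 else 2 : ZMod 4) =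
        (if a = 0 then (if b = 0 then 0 else 1) else if b = 0 then 3 else 2) + 1 := by decide
  simpa [cubeAngle, twist] using first_two _ _

theorem tailDist_twist (x y : Fin n → ZMod 2) : tailDist (twist hn x) y = tailDist x y := by
  unfold tailDist
  congr 1
  refine Finset.filter_congr fun i _ => and_congr_right fun hi => ?_
  have ne_zero : i.val ≠ 0 := by omega
  have ne_one : i.val ≠ 1 := by omega
  simp [twist, ne_zero, ne_one]

theorem tailDist_comm (x y : Fin n → ZMod 2) : tailDist x y = tailDist y x := by
  simp [tailDist, ne_comm]

/-- The power `τ ^ s` of the twist `τ`, which depends only on `s` modulo 4. -/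
def cubeRot (s : ZMod 4) : (Fin n → ZMod 2) → Fin n → ZMod 2 := (twist hn)^[s.val]

theorem cubeRot_zero (x : Fin n → ZMod 2) : cubeRot hn 0 x = x := rfl

theorem cubeRot_one (x : Fin n → ZMod 2) : cubeRot hn 1 x = twist hn x := rfl

theorem cubeAngle_cubeRot (s : ZMod 4) (x : Fin n → ZMod 2) :
    cubeAngle hn (cubeRot hn s x) = cubeAngle hn x + s := by
  have angle_iterate : ∀ m : ℕ, cubeAngle hn ((twist hn)^[m] x) = cubeAngle hn x + m := by
    intro m
    induction m with
    | zero => simp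
    | succ m ih => rw [Function.iterate_succ_apply', cubeAngle_twist, ih, Nat.cast_succ, add_assoc]
  rw [cubeRot, angle_iterate, ZMod.natCast_zmod_val]

theorem tailDist_cubeRot (s : ZMod 4) (x y : Fin n → ZMod 2) :
    tailDist (cubeRot hn s x) y = tailDist x y := by
  have tail_iterate : ∀ m : ℕ, tailDist ((twist hn)^[m] x) y = tailDist x y := by
    intro m
    induction m with
    | zero => rfl
    | succ m ih => rw [Function.iterate_succ_apply', tailDist_twist, ih]
  exact tail_iterate _

theorem hammingDist_cubeRot (s s' : ZMod 4) (x y : Fin n → ZMod 2) :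
    hammingDist (cubeRot hn s x) (cubeRot hn s' y) =
      cycleNorm (cubeAngle hn x + s - (cubeAngle hn y + s')) + tailDist x y := by
  rw [hammingDist_eq_cycleNorm_add_tailDist hn, cubeAngle_cubeRot, cubeAngle_cubeRot,
    tailDist_cubeRot, tailDist_comm, tailDist_cubeRot, tailDist_comm]

end Twist

section Sign

variable {V : Type*}

/-- The relation `r` as a sign in `ℤ/4`: `1` if `r i j`, `-1` if only `r j i`, and `0` otherwise. -/
def arcSign (r : V → V → Prop) [DecidableRel r] (i j : V) : ZMod 4 :=
  if r i j then 1 else if r j i then -1 else 0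

instance : DecidableRel T4Arc := fun u v => by
  unfold T4Arc
  infer_instance

namespace Tournament

theorem arc_injective : Function.Injective (arc (V := V)) := by
  rintro ⟨_, _, _, _⟩ ⟨_, _, _, _⟩ rfl
  rfl

variable (T : Tournament V)

open Classical in
/-- The number of twists, in `ℤ/4`, on the way from the cubes of `i` to those of `j`: `1` if
`i → j`, `-1` if `j → i`, and `0` if `i = j`. -/
noncomputable def sign (i j : V) : ZMod 4 := arcSign T.arc i j

theorem sign_self (i : V) : T.sign i i = 0 := by simp [sign, arcSign, T.irrefl]

variable {T}

theorem sign_of_arc {i j : V} (h : T.arc i j) : T.sign i j = 1 := by simp [sign, arcSign, h]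

theorem sign_of_arc_swap {i j : V} (h : T.arc j i) : T.sign i j = -1 := by
  simp [sign, arcSign, h, T.asymm _ _ h]

variable (T)

theorem sign_swap (i j : V) : T.sign j i = -T.sign i j := by
  rcases eq_or_ne i j with rfl | hij
  · simp [sign_self]
  · rcases T.total i j hij with h | h
    · rw [sign_of_arc h, sign_of_arc_swap h]
    · rw [sign_of_arc h, sign_of_arc_swap h, neg_neg]

theorem sign_eq_one_or_neg_one {i j : V} (h : i ≠ j) : T.sign i j = 1 ∨ T.sign i j = -1 :=
  (T.total i j h).imp sign_of_arc sign_of_arc_swap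

/-- Reversing the arcs at a set of vertices changes `T.sign i j` by a coboundary modulo 4, so this
says that after such a switching at `w` the triangle `a, b, c` becomes cyclic. -/
theorem IsShattered.exists_sign {T : Tournament V} (hT : T.IsShattered) {a b c : V} (hab : a ≠ b)
    (hbc : b ≠ c) (hca : c ≠ a) :
    ∃ w, (w ≠ a ∧ w ≠ b ∧ w ≠ c) ∧ ∃ ε : ZMod 4, (ε = 1 ∨ ε = -1) ∧
      T.sign a b = ε + T.sign w b - T.sign w a ∧ T.sign b c = ε + T.sign w c - T.sign w b ∧
      T.sign c a = ε + T.sign w a - T.sign w c := by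
  obtain ⟨f, ⟨i, rfl⟩, ⟨j, rfl⟩, ⟨l, rfl⟩, hf⟩ := hT a b c hab hca.symm hbc
  have transfer (s : Fin 4 → Fin 4 → ZMod 4) (hs : ∀ u v, T.sign (f u) (f v) = s u v)
      (h : ∀ i j l, i ≠ j → j ≠ l → l ≠ i → ∃ w, (w ≠ i ∧ w ≠ j ∧ w ≠ l) ∧ ∃ ε : ZMod 4,
        (ε = 1 ∨ ε = -1) ∧ s i j = ε + s w j - s w i ∧ s j l = ε + s w l - s w j ∧
          s l i = ε + s w i - s w l) :
      ∃ w, (w ≠ f i ∧ w ≠ f j ∧ w ≠ f l) ∧ ∃ ε : ZMod 4, (ε = 1 ∨ ε = -1) ∧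
        T.sign (f i) (f j) = ε + T.sign w (f j) - T.sign w (f i) ∧
        T.sign (f j) (f l) = ε + T.sign w (f l) - T.sign w (f j) ∧
        T.sign (f l) (f i) = ε + T.sign w (f i) - T.sign w (f l) := by
    obtain ⟨w, hw, hε⟩ := h i j l (ne_of_apply_ne f hab) (ne_of_apply_ne f hbc)
      (ne_of_apply_ne f hca)
    refine ⟨f w, ?_, ?_⟩
    · simpa only [ne_eq, f.apply_eq_iff_eq] using hw
    · simpa only [hs] using hε
  rcases hf with hf | hf
  · exact transfer (arcSign T4Arc) (fun u v => by simp [sign, arcSign, hf]) (by decide)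
  · exact transfer (arcSign fun u v => T4Arc v u) (fun u v => by simp [sign, arcSign, hf])
      (by decide)

end Tournament

end Sign

section Frames

variable {V : Type*} {m k : ℕ}

/-- The type of vertices of `G_T(m, k)`. -/
abbrev TwistedVertex (V : Type*) (m k : ℕ) := V × Fin m × (Fin (3 * k - 1) → ZMod 2)

/-- The pair `(i, j)` indexing the copy of the cube that contains a vertex `(i, j, x)` of
`G_T(m, k)`. -/
def TwistedVertex.cell (p : TwistedVertex V m k) : V × Fin m := (p.1, p.2.1)

theorem TwistedVertex.fst_eq_of_eq_cell {i : V} {j : Fin m} {p : TwistedVertex V m k}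
    (h : (i, j) = p.cell) : i = p.1 := congrArg Prod.fst h

theorem TwistedVertex.snd_eq_of_eq_cell {i : V} {j : Fin m} {p : TwistedVertex V m k}
    (h : (i, j) = p.cell) : j = p.2.1 := congrArg Prod.snd h

namespace Tournament

variable (T : Tournament V) (hk : 1 ≤ k)

/-- The cube coordinates of a vertex of `G_T(m, k)` as seen from the tournament vertex `w`, that is,
twisted along the arc between `w` and the vertex. -/
noncomputable def frame (w : V) (p : TwistedVertex V m k) : Fin (3 * k - 1) → ZMod 2 :=
  cubeRot (by omega) (T.sign w p.1) p.2.2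

/-- The Hamming distance of two vertices of `G_T(m, k)` as seen from `w`. -/
noncomputable def frameDist (w : V) (p q : TwistedVertex V m k) : ℕ :=
  hammingDist (T.frame hk w p) (T.frame hk w q)

/-- The Hamming distance of two vertices of `G_T(m, k)` after the twist between their cubes. It
governs adjacency. -/
noncomputable def twistDist (p q : TwistedVertex V m k) : ℕ := T.frameDist hk p.1 p q

/-- The angle of the first two coordinates of a vertex of `G_T(m, k)` as seen from `w`. -/
noncomputable def frameAngle (w : V) (p : TwistedVertex V m k) : ZMod 4 :=
  cubeAngle (by omega) p.2.2 + T.sign w p.1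

variable (w : V) (p q : TwistedVertex V m k)

theorem frameDist_eq_cycleNorm_add_tailDist : T.frameDist hk w p q =
    cycleNorm (T.frameAngle hk w p - T.frameAngle hk w q) + tailDist p.2.2 q.2.2 :=
  hammingDist_cubeRot _ _ _ _ _

theorem frame_self : T.frame hk p.1 p = p.2.2 := by
  rw [frame, sign_self, cubeRot_zero]

theorem frameDist_comm : T.frameDist hk w p q = T.frameDist hk w q p := hammingDist_comm _ _

variable {w p q} in
theorem frameDist_eq_twistDist (h : w = p.1 ∨ p.1 = q.1 ∨ q.1 = w) :
    T.frameDist hk w p q = T.twistDist hk p q := by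
  have angle_eq : T.frameAngle hk w p - T.frameAngle hk w q =
      T.frameAngle hk p.1 p - T.frameAngle hk p.1 q := by
    simp only [frameAngle, sign_self]
    rcases h with rfl | h | rfl
    · rw [sign_self]
    · rw [h, sign_self]
      ring
    · rw [sign_self, T.sign_swap p.1 q.1]
      ring
  rw [twistDist, frameDist_eq_cycleNorm_add_tailDist, angle_eq,
    ← frameDist_eq_cycleNorm_add_tailDist]

theorem twistDist_comm : T.twistDist hk p q = T.twistDist hk q p := by
  rw [← T.frameDist_eq_twistDist hk (Or.inr (Or.inr rfl)), frameDist_comm, twistDist]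

theorem twistDist_le : T.twistDist hk p q ≤ 3 * k - 1 := by
  simpa [twistDist, frameDist] using
    hammingDist_le_card_fintype (x := T.frame hk p.1 p) (y := T.frame hk p.1 q)

variable {p q} in
theorem twistDist_of_fst_eq (h : p.1 = q.1) : T.twistDist hk p q = hammingDist p.2.2 q.2.2 := by
  rw [twistDist, frameDist, frame_self, h, frame_self]

variable {p q} in
theorem twistDist_of_arc (h : T.arc p.1 q.1) :
    T.twistDist hk p q = hammingDist p.2.2 (twist (by omega) q.2.2) := by
  rw [twistDist, frameDist, frame_self, frame, sign_of_arc h, cubeRot_one]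

end Tournament

end Frames

section Adjacency

open TwistedVertex

variable {V : Type*} {m k : ℕ} (T : Tournament V) (hk : 1 ≤ k) {p q : TwistedVertex V m k}

theorem twistedGraph_adj_of_cell_eq (h : p.cell = q.cell) : (twistedGraph T m k hk).Adj p q ↔
    T.twistDist hk p q + 1 = 2 * k ∨ 2 * k + 1 ≤ T.twistDist hk p q := by
  have hi : p.1 = q.1 := fst_eq_of_eq_cell h
  have hj : p.2.1 = q.2.1 := snd_eq_of_eq_cell h
  have hle := T.twistDist_le hk p q
  have hcomm : hammingDist q.2.2 p.2.2 = hammingDist p.2.2 q.2.2 := hammingDist_comm _ _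
  have hne : p ≠ q ↔ hammingDist p.2.2 q.2.2 ≠ 0 := by
    rw [hammingDist_ne_zero, not_iff_not, Prod.ext_iff, Prod.ext_iff]
    simp [hi, hj]
  rw [twistedGraph, SimpleGraph.fromRel_adj]
  rw [T.twistDist_of_fst_eq hk hi] at hle ⊢
  simp only [hne, hi, hj, hcomm, T.irrefl, true_and, false_and, or_false, Finset.mem_Icc, ne_eq,
    not_true_eq_false]
  omega

theorem twistedGraph_adj_of_cell_ne (h : p.cell ≠ q.cell) :
    (twistedGraph T m k hk).Adj p q ↔ 2 * k ≤ T.twistDist hk p q := by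
  have hle := T.twistDist_le hk p q
  have hpq : p ≠ q := fun hpq => h (hpq ▸ rfl)
  rw [twistedGraph, SimpleGraph.fromRel_adj]
  by_cases hi : p.1 = q.1
  · have hj : p.2.1 ≠ q.2.1 := fun hj => h (Prod.ext hi hj)
    have hcomm : hammingDist q.2.2 p.2.2 = hammingDist p.2.2 q.2.2 := hammingDist_comm _ _
    rw [T.twistDist_of_fst_eq hk hi] at hle ⊢
    simp only [hpq, hi, hj, hj.symm, hcomm, T.irrefl, true_and, false_and, and_false, false_or,
      or_false, Finset.mem_Icc, ne_eq, not_false_eq_true]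
    omega
  · rcases T.total _ _ hi with harc | harc
    · have hdist := T.twistDist_of_arc hk harc
      simp only [hpq, hi, Ne.symm hi, harc, T.asymm _ _ harc, true_and, false_and, false_or,
        or_false, Finset.mem_Icc, ne_eq, not_false_eq_true]
      omega
    · have hdist := T.twistDist_of_arc hk harc
      rw [T.twistDist_comm] at hdist
      simp only [hpq, hi, Ne.symm hi, harc, T.asymm _ _ harc, true_and, false_and, false_or,
        Finset.mem_Icc, ne_eq, not_false_eq_true]
      omega

variable {w : V} {l : Fin m} {u : Fin (3 * k - 1) → ZMod 2}

theorem Tournament.twistDist_add_one_add_hammingDist :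
    T.twistDist hk (w, l, u + 1) q + hammingDist u (T.frame hk w q) = 3 * k - 1 := by
  rw [twistDist, frameDist, frame_self, hammingDist_add_one, Fintype.card_fin]

theorem twistedGraph_adj_add_one_of_cell_eq (h : (w, l) = q.cell) :
    (twistedGraph T m k hk).Adj (w, l, u + 1) q ↔
      hammingDist u (T.frame hk w q) = k ∨ hammingDist u (T.frame hk w q) + 2 ≤ k := by
  have hsum := T.twistDist_add_one_add_hammingDist hk (q := q) (w := w) (l := l) (u := u)
  rw [twistedGraph_adj_of_cell_eq T hk h]
  omega

theorem twistedGraph_adj_add_one_of_cell_ne (h : (w, l) ≠ q.cell) :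
    (twistedGraph T m k hk).Adj (w, l, u + 1) q ↔ hammingDist u (T.frame hk w q) < k := by
  have hsum := T.twistDist_add_one_add_hammingDist hk (q := q) (w := w) (l := l) (u := u)
  rw [twistedGraph_adj_of_cell_ne T hk h]
  omega

end Adjacency

section Cliques

open TwistedVertex

variable {V : Type*} {m k : ℕ} (T : Tournament V) (hk : 1 ≤ k) {p q r : TwistedVertex V m k}

theorem Tournament.exists_frameDist_add_eq_two_mul (w : V) (p q r : TwistedVertex V m k) :
    ∃ s ≤ 3 * k - 1,
      T.frameDist hk w p q + T.frameDist hk w p r + T.frameDist hk w q r = 2 * s := by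
  simpa only [Tournament.frameDist, Fintype.card_fin] using 
    exists_hammingDist_add_eq_two_mul (T.frame hk w p) (T.frame hk w q) (T.frame hk w r)

theorem Tournament.exists_twistDist_add_eq_two_mul (h : p.1 = q.1 ∨ q.1 = r.1 ∨ r.1 = p.1) :
    ∃ s ≤ 3 * k - 1, T.twistDist hk p q + T.twistDist hk q r + T.twistDist hk r p = 2 * s := by
  obtain ⟨s, hs, hsum⟩ := T.exists_frameDist_add_eq_two_mul hk p.1 p q r
  rw [T.frameDist_eq_twistDist hk h, ← twistDist, ← twistDist, T.twistDist_comm hk p r] at hsum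
  exact ⟨s, hs, by omega⟩

theorem Tournament.twistDist_le_frameDist_add_one (hpq : p.1 ≠ q.1) (hqr : q.1 ≠ r.1)
    (hrp : r.1 ≠ p.1) : T.twistDist hk q r ≤ T.frameDist hk p.1 q r + 1 := by
  have cycleNorm_sub_le : ∀ x a b c : ZMod 4, (a = 1 ∨ a = -1) → (b = 1 ∨ b = -1) →
      (c = 1 ∨ c = -1) → cycleNorm (x - c) ≤ cycleNorm (x + (a - b)) + 1 := by decide
  have hle := cycleNorm_sub_le (T.frameAngle hk q.1 q - T.frameAngle hk r.1 r) _ _ _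
    (T.sign_eq_one_or_neg_one hpq) (T.sign_eq_one_or_neg_one hrp.symm)
    (T.sign_eq_one_or_neg_one hqr)
  rw [twistDist, frameDist_eq_cycleNorm_add_tailDist, frameDist_eq_cycleNorm_add_tailDist]
  convert Nat.add_le_add_right hle (tailDist q.2.2 r.2.2) using 1
  · simp only [frameAngle, sign_self]
    ring_nf
  · rw [add_right_comm]
    simp only [frameAngle, sign_self]
    ring_nf

theorem two_mul_le_twistDist_add_one (h : (twistedGraph T m k hk).Adj p q) :
    2 * k ≤ T.twistDist hk p q + 1 := by
  by_cases hcell : p.cell = q.cell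
  · rw [twistedGraph_adj_of_cell_eq T hk hcell] at h
    omega
  · rw [twistedGraph_adj_of_cell_ne T hk hcell] at h
    omega

/-- The three distances would have an even sum of at most `6 k - 2`; it is at least `6 k - 3`, and
at least `6 k - 1` unless it is odd. -/
theorem twistedGraph_not_adj_of_fst_eq (h : p.1 = q.1 ∨ q.1 = r.1 ∨ r.1 = p.1)
    (hpq : (twistedGraph T m k hk).Adj p q) (hqr : (twistedGraph T m k hk).Adj q r) :
    ¬ (twistedGraph T m k hk).Adj r p := by
  intro hrp
  obtain ⟨s, hs, hsum⟩ := T.exists_twistDist_add_eq_two_mul hk h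
  have dpq := two_mul_le_twistDist_add_one T hk hpq
  have dqr := two_mul_le_twistDist_add_one T hk hqr
  have drp := two_mul_le_twistDist_add_one T hk hrp
  by_cases cpq : p.cell = q.cell <;> by_cases cqr : q.cell = r.cell
  · rw [twistedGraph_adj_of_cell_eq T hk cpq] at hpq
    rw [twistedGraph_adj_of_cell_eq T hk cqr] at hqr
    rw [twistedGraph_adj_of_cell_eq T hk (cpq.trans cqr).symm] at hrp
    omega
  · rw [twistedGraph_adj_of_cell_ne T hk cqr] at hqr
    rw [twistedGraph_adj_of_cell_ne T hk fun crp => cqr (cpq.symm.trans crp.symm)] at hrp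
    omega
  · rw [twistedGraph_adj_of_cell_ne T hk cpq] at hpq
    rw [twistedGraph_adj_of_cell_ne T hk fun crp => cpq (crp.symm.trans cqr.symm)] at hrp
    omega
  · rw [twistedGraph_adj_of_cell_ne T hk cpq] at hpq
    rw [twistedGraph_adj_of_cell_ne T hk cqr] at hqr
    omega

theorem twistedGraph_not_adj (hpq : (twistedGraph T m k hk).Adj p q)
    (hqr : (twistedGraph T m k hk).Adj q r) : ¬ (twistedGraph T m k hk).Adj r p := by
  by_cases h : p.1 = q.1 ∨ q.1 = r.1 ∨ r.1 = p.1
  · exact twistedGraph_not_adj_of_fst_eq T hk h hpq hqr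
  intro hrp
  obtain ⟨bpq, bqr, brp⟩ : p.1 ≠ q.1 ∧ q.1 ≠ r.1 ∧ r.1 ≠ p.1 := by
    simpa only [not_or] using h
  have hframe := T.twistDist_le_frameDist_add_one hk bpq bqr brp
  obtain ⟨s, hs, hsum⟩ := T.exists_frameDist_add_eq_two_mul hk p.1 p q r
  rw [← Tournament.twistDist, ← Tournament.twistDist, T.twistDist_comm hk p r] at hsum
  rw [twistedGraph_adj_of_cell_ne T hk fun c => bpq (fst_eq_of_eq_cell c)] at hpq
  rw [twistedGraph_adj_of_cell_ne T hk fun c => bqr (fst_eq_of_eq_cell c)] at hqr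
  rw [twistedGraph_adj_of_cell_ne T hk fun c => brp (fst_eq_of_eq_cell c)] at hrp
  omega

theorem twistedGraph_cliqueFree_three : (twistedGraph T m k hk).CliqueFree 3 := by
  classical
  intro _ hclique
  obtain ⟨p, q, r, hpq, hpr, hqr, -⟩ := SimpleGraph.is3Clique_iff.1 hclique
  exact twistedGraph_not_adj T hk hpq hqr hpr.symm

end Cliques

section CommonNeighbors

open TwistedVertex

/-- Three vertices have a common neighbour. -/
def HasCommonNeighbor {W : Type*} (G : SimpleGraph W) (p q r : W) : Prop :=
  ∃ v, G.Adj v p ∧ G.Adj v q ∧ G.Adj v r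

theorem HasCommonNeighbor.rotate {W : Type*} {G : SimpleGraph W} {p q r : W} :
    HasCommonNeighbor G p q r → HasCommonNeighbor G q r p :=
  fun ⟨v, hp, hq, hr⟩ => ⟨v, hq, hr, hp⟩

theorem HasCommonNeighbor.swap {W : Type*} {G : SimpleGraph W} {p q r : W} :
    HasCommonNeighbor G p q r → HasCommonNeighbor G q p r :=
  fun ⟨v, hp, hq, hr⟩ => ⟨v, hq, hp, hr⟩

variable {V : Type*} {m k : ℕ} (T : Tournament V) (hk : 1 ≤ k) {p q r : TwistedVertex V m k}

theorem twistDist_lt_of_not_adj (hcell : p.cell ≠ q.cell) (h : ¬ (twistedGraph T m k hk).Adj p q) :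
    T.twistDist hk p q < 2 * k := by
  rwa [twistedGraph_adj_of_cell_ne T hk hcell, not_le] at h

theorem twistDist_le_of_not_adj (h : ¬ (twistedGraph T m k hk).Adj p q) :
    T.twistDist hk p q ≤ 2 * k := by
  by_cases hcell : p.cell = q.cell
  · rw [twistedGraph_adj_of_cell_eq T hk hcell] at h
    omega
  · exact (twistDist_lt_of_not_adj T hk hcell h).le

theorem hasCommonNeighbor_of_frameDist_le {w : V} {l : Fin m} (cp : (w, l) ≠ p.cell)
    (cq : (w, l) ≠ q.cell) (cr : (w, l) ≠ r.cell) (hpq : T.frameDist hk w p q + 2 ≤ 2 * k)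
    (hpr : T.frameDist hk w p r + 2 ≤ 2 * k) (hqr : T.frameDist hk w q r + 2 ≤ 2 * k) :
    HasCommonNeighbor (twistedGraph T m k hk) p q r := by
  obtain ⟨u, hp, hq, hr⟩ := exists_hammingDist_lt _ _ _ hpq hpr hqr
  exact ⟨(w, l, u + 1), (twistedGraph_adj_add_one_of_cell_ne T hk cp).2 hp,
    (twistedGraph_adj_add_one_of_cell_ne T hk cq).2 hq,
    (twistedGraph_adj_add_one_of_cell_ne T hk cr).2 hr⟩

theorem hasCommonNeighbor_of_twistDist_add_one_eq (cq : p.cell ≠ q.cell) (cr : p.cell ≠ r.cell)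
    (hpq : T.twistDist hk p q + 1 = 2 * k) (hpr : T.twistDist hk p r + 1 ≤ 2 * k)
    (hqr : T.frameDist hk p.1 q r + 2 ≤ 2 * k) :
    HasCommonNeighbor (twistedGraph T m k hk) p q r := by
  obtain ⟨u, hp, hq, hr⟩ := exists_hammingDist_eq_lt_lt (T.frame hk p.1 p) (T.frame hk p.1 q)
    (T.frame hk p.1 r) hpq hpr hqr
  exact ⟨(p.1, p.2.1, u + 1), (twistedGraph_adj_add_one_of_cell_eq T hk rfl).2 (Or.inl hp),
    (twistedGraph_adj_add_one_of_cell_ne T hk cq).2 hq,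
    (twistedGraph_adj_add_one_of_cell_ne T hk cr).2 hr⟩

theorem hasCommonNeighbor_of_twistDist_eq_two_mul (cpq : p.cell = q.cell)
    (hpq : T.twistDist hk p q = 2 * k) (nqr : ¬ (twistedGraph T m k hk).Adj q r)
    (nrp : ¬ (twistedGraph T m k hk).Adj r p) :
    HasCommonNeighbor (twistedGraph T m k hk) p q r := by
  obtain ⟨u, hp, hq, hr⟩ := exists_hammingDist_eq_eq_max _ _ (T.frame hk p.1 r) hpq
  change hammingDist u _ + k = max (T.frameDist hk p.1 p r) (T.frameDist hk p.1 q r) at hr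
  rw [T.frameDist_eq_twistDist hk (Or.inl rfl), T.twistDist_comm hk p r,
    T.frameDist_eq_twistDist hk (Or.inl (fst_eq_of_eq_cell cpq))] at hr
  refine ⟨(p.1, p.2.1, u + 1), (twistedGraph_adj_add_one_of_cell_eq T hk rfl).2 (Or.inl hp),
    (twistedGraph_adj_add_one_of_cell_eq T hk cpq).2 (Or.inl hq), ?_⟩
  by_cases cr : p.cell = r.cell
  · rw [twistedGraph_adj_add_one_of_cell_eq T hk cr]
    rw [twistedGraph_adj_of_cell_eq T hk (cpq.symm.trans cr)] at nqr
    rw [twistedGraph_adj_of_cell_eq T hk cr.symm] at nrp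
    omega
  · rw [twistedGraph_adj_add_one_of_cell_ne T hk cr]
    have dqr := twistDist_lt_of_not_adj T hk (fun h => cr (cpq.trans h)) nqr
    have drp := twistDist_lt_of_not_adj T hk (Ne.symm cr) nrp
    omega

/-- By parity one of the other two distances is at most `2 k - 2`, so that the common neighbour can
be taken in the cell of `p` or in that of `q`. -/
theorem hasCommonNeighbor_of_fst_eq_of_twistDist_add_one_eq
    (h : p.1 = q.1 ∨ q.1 = r.1 ∨ r.1 = p.1) (npq : ¬ (twistedGraph T m k hk).Adj p q)
    (nqr : ¬ (twistedGraph T m k hk).Adj q r) (nrp : ¬ (twistedGraph T m k hk).Adj r p)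
    (dpq : T.twistDist hk p q + 1 = 2 * k) (dqr : T.twistDist hk q r < 2 * k)
    (drp : T.twistDist hk r p < 2 * k) : HasCommonNeighbor (twistedGraph T m k hk) p q r := by
  obtain ⟨s, -, hsum⟩ := T.exists_twistDist_add_eq_two_mul hk h
  have cpq : p.cell ≠ q.cell := fun c => by
    rw [twistedGraph_adj_of_cell_eq T hk c] at npq
    omega
  have via_p (cpr : p.cell ≠ r.cell) (dqr' : T.twistDist hk q r + 2 ≤ 2 * k) :
      HasCommonNeighbor (twistedGraph T m k hk) p q r := by
    rw [T.twistDist_comm] at drp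
    exact hasCommonNeighbor_of_twistDist_add_one_eq T hk cpq cpr dpq (by omega)
      (by rwa [T.frameDist_eq_twistDist hk h])
  have via_q (cqr : q.cell ≠ r.cell) (drp' : T.twistDist hk r p + 2 ≤ 2 * k) :
      HasCommonNeighbor (twistedGraph T m k hk) p q r := by
    rw [T.twistDist_comm] at dpq
    refine (hasCommonNeighbor_of_twistDist_add_one_eq T hk cpq.symm cqr dpq (by omega) ?_).swap
    rwa [T.frameDist_comm, T.frameDist_eq_twistDist hk (by tauto)]
  by_cases crp : r.cell = p.cell
  · refine via_q (fun c => cpq (crp.symm.trans c.symm)) ?_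
    rw [twistedGraph_adj_of_cell_eq T hk crp] at nrp
    omega
  by_cases cqr : q.cell = r.cell
  · refine via_p (Ne.symm crp) ?_
    rw [twistedGraph_adj_of_cell_eq T hk cqr] at nqr
    omega
  by_cases drp' : T.twistDist hk r p + 2 ≤ 2 * k
  · exact via_q cqr drp'
  · exact via_p (Ne.symm crp) (by omega)

theorem hasCommonNeighbor_of_twistDist_add_two_le [Nontrivial V] [Nontrivial (Fin m)]
    (h : p.1 = q.1) (dpq : T.twistDist hk p q + 2 ≤ 2 * k) (dqr : T.twistDist hk q r + 2 ≤ 2 * k)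
    (drp : T.twistDist hk r p + 2 ≤ 2 * k) :
    HasCommonNeighbor (twistedGraph T m k hk) p q r := by
  rw [T.twistDist_comm] at drp
  have frame_pq (w : V) : T.frameDist hk w p q + 2 ≤ 2 * k := by
    rwa [T.frameDist_eq_twistDist hk (Or.inr (Or.inl h))]
  by_cases hr : p.1 = r.1
  · obtain ⟨w, hw⟩ := exists_ne p.1
    refine hasCommonNeighbor_of_frameDist_le T hk (w := w) (l := p.2.1)
      (fun c => hw (fst_eq_of_eq_cell c)) (fun c => hw ((fst_eq_of_eq_cell c).trans h.symm))
      (fun c => hw ((fst_eq_of_eq_cell c).trans hr.symm)) (frame_pq w) ?_ ?_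
    · rwa [T.frameDist_eq_twistDist hk (Or.inr (Or.inl hr))]
    · rwa [T.frameDist_eq_twistDist hk (Or.inr (Or.inl (h.symm.trans hr)))]
  · obtain ⟨l, hl⟩ := exists_ne r.2.1
    refine hasCommonNeighbor_of_frameDist_le T hk (w := r.1) (l := l)
      (fun c => hr (fst_eq_of_eq_cell c).symm)
      (fun c => hr (h.trans (fst_eq_of_eq_cell c).symm)) (fun c => hl (snd_eq_of_eq_cell c))
      (frame_pq r.1) ?_ ?_ <;>
    rwa [T.frameDist_eq_twistDist hk (Or.inr (Or.inr rfl))]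

theorem hasCommonNeighbor_of_fst_eq [Nontrivial V] [Nontrivial (Fin m)]
    (h : p.1 = q.1 ∨ q.1 = r.1 ∨ r.1 = p.1) (npq : ¬ (twistedGraph T m k hk).Adj p q)
    (nqr : ¬ (twistedGraph T m k hk).Adj q r) (nrp : ¬ (twistedGraph T m k hk).Adj r p) :
    HasCommonNeighbor (twistedGraph T m k hk) p q r := by
  have same_cell {x y : TwistedVertex V m k} (nxy : ¬ (twistedGraph T m k hk).Adj x y)
      (d : T.twistDist hk x y = 2 * k) : x.cell = y.cell :=
    by_contra fun c => (twistDist_lt_of_not_adj T hk c nxy).ne d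
  have lt_of_ne {x y : TwistedVertex V m k} (nxy : ¬ (twistedGraph T m k hk).Adj x y)
      (d : T.twistDist hk x y ≠ 2 * k) : T.twistDist hk x y < 2 * k :=
    (twistDist_le_of_not_adj T hk nxy).lt_of_ne d
  by_cases epq : T.twistDist hk p q = 2 * k
  · exact hasCommonNeighbor_of_twistDist_eq_two_mul T hk (same_cell npq epq) epq nqr nrp
  by_cases eqr : T.twistDist hk q r = 2 * k
  · exact (hasCommonNeighbor_of_twistDist_eq_two_mul T hk (same_cell nqr eqr) eqr nrp
      npq).rotate.rotate
  by_cases erp : T.twistDist hk r p = 2 * k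
  · exact (hasCommonNeighbor_of_twistDist_eq_two_mul T hk (same_cell nrp erp) erp npq nqr).rotate
  have dpq := lt_of_ne npq epq
  have dqr := lt_of_ne nqr eqr
  have drp := lt_of_ne nrp erp
  by_cases opq : T.twistDist hk p q + 1 = 2 * k
  · exact hasCommonNeighbor_of_fst_eq_of_twistDist_add_one_eq T hk h npq nqr nrp opq dqr drp
  by_cases oqr : T.twistDist hk q r + 1 = 2 * k
  · exact (hasCommonNeighbor_of_fst_eq_of_twistDist_add_one_eq T hk (by tauto) nqr nrp npq oqr drp
      dpq).rotate.rotate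
  by_cases orp : T.twistDist hk r p + 1 = 2 * k
  · exact (hasCommonNeighbor_of_fst_eq_of_twistDist_add_one_eq T hk (by tauto) nrp npq nqr orp dpq
      dqr).rotate
  rcases h with h | h | h
  · exact hasCommonNeighbor_of_twistDist_add_two_le T hk h (by omega) (by omega) (by omega)
  · exact (hasCommonNeighbor_of_twistDist_add_two_le T hk h (by omega) (by omega)
      (by omega)).rotate.rotate
  · exact (hasCommonNeighbor_of_twistDist_add_two_le T hk h (by omega) (by omega)
      (by omega)).rotate

theorem hasCommonNeighbor_of_frameDist_add_two_le [Nontrivial (Fin m)] (bpq : p.1 ≠ q.1)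
    (brp : r.1 ≠ p.1) (dpq : T.twistDist hk p q < 2 * k) (drp : T.twistDist hk r p < 2 * k)
    (dqr : T.frameDist hk p.1 q r + 2 ≤ 2 * k) :
    HasCommonNeighbor (twistedGraph T m k hk) p q r := by
  have cpq : p.cell ≠ q.cell := fun c => bpq (fst_eq_of_eq_cell c)
  have cpr : p.cell ≠ r.cell := fun c => brp (fst_eq_of_eq_cell c).symm
  rw [T.twistDist_comm] at drp
  by_cases opq : T.twistDist hk p q + 1 = 2 * k
  · exact hasCommonNeighbor_of_twistDist_add_one_eq T hk cpq cpr opq drp dqr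
  by_cases opr : T.twistDist hk p r + 1 = 2 * k
  · rw [T.frameDist_comm] at dqr
    exact (hasCommonNeighbor_of_twistDist_add_one_eq T hk cpr cpq opr dpq dqr).rotate.rotate.swap
  obtain ⟨l, hl⟩ := exists_ne p.2.1
  refine hasCommonNeighbor_of_frameDist_le T hk (w := p.1) (l := l)
    (fun c => hl (snd_eq_of_eq_cell c))
    (fun c => bpq (fst_eq_of_eq_cell c))
    (fun c => brp (fst_eq_of_eq_cell c).symm) ?_ ?_ dqr
  · rw [← Tournament.twistDist]
    omega
  · rw [← Tournament.twistDist]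
    omega

variable {T}

theorem Tournament.twistDist_eq_of_sign {w : V} {ε : ZMod 4}
    (h : T.sign p.1 q.1 = ε + T.sign w q.1 - T.sign w p.1) : T.twistDist hk p q =
      cycleNorm (T.frameAngle hk w p - T.frameAngle hk w q - ε) + tailDist p.2.2 q.2.2 := by
  rw [twistDist, frameDist_eq_cycleNorm_add_tailDist]
  simp only [frameAngle, sign_self, h]
  ring_nf

theorem Tournament.frameDist_eq_of_sign {w : V} {ε : ZMod 4}
    (hqr : T.sign q.1 r.1 = ε + T.sign w r.1 - T.sign w q.1)
    (hrp : T.sign r.1 p.1 = ε + T.sign w p.1 - T.sign w r.1) : T.frameDist hk r.1 p q =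
      cycleNorm (T.frameAngle hk w p - T.frameAngle hk w q + 2 * ε) + tailDist p.2.2 q.2.2 := by
  rw [frameDist_eq_cycleNorm_add_tailDist]
  simp only [frameAngle, T.sign_swap q.1 r.1, hqr, hrp]
  ring_nf

/-- Here `x`, `y`, `z` are the angle differences of three vertices as seen from a fourth base `w`.
In the first three cases a common neighbour is found in the frame of one of the three, in the last
case in that of `w`. -/
theorem cycleNorm_lt_or_cycleNorm_lt_of_add_eq_zero : ∀ x y z ε : ZMod 4, x + y + z = 0 →
    (ε = 1 ∨ ε = -1) →
    cycleNorm (x + 2 * ε) < cycleNorm (x - ε) ∨ cycleNorm (y + 2 * ε) < cycleNorm (y - ε) ∨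
      cycleNorm (z + 2 * ε) < cycleNorm (z - ε) ∨
      cycleNorm x < cycleNorm (x - ε) ∧ cycleNorm y < cycleNorm (y - ε) ∧
        cycleNorm z < cycleNorm (z - ε) := by
  decide

theorem Tournament.IsShattered.hasCommonNeighbor [Nontrivial (Fin m)] (hT : T.IsShattered)
    (bpq : p.1 ≠ q.1) (bqr : q.1 ≠ r.1) (brp : r.1 ≠ p.1)
    (dpq : T.twistDist hk p q < 2 * k) (dqr : T.twistDist hk q r < 2 * k)
    (drp : T.twistDist hk r p < 2 * k) : HasCommonNeighbor (twistedGraph T m k hk) p q r := by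
  obtain ⟨w, ⟨wp, wq, wr⟩, ε, hε, spq, sqr, srp⟩ := hT.exists_sign bpq bqr brp
  have tpq := twistDist_eq_of_sign hk spq
  have tqr := twistDist_eq_of_sign hk sqr
  have trp := twistDist_eq_of_sign hk srp
  have sum_eq_zero : T.frameAngle hk w p - T.frameAngle hk w q +
      (T.frameAngle hk w q - T.frameAngle hk w r) +
      (T.frameAngle hk w r - T.frameAngle hk w p) = 0 := by ring
  rcases cycleNorm_lt_or_cycleNorm_lt_of_add_eq_zero _ _ _ ε sum_eq_zero hε with
    h | h | h | ⟨hpq, hqr, hrp⟩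
  · have fpq := T.frameDist_eq_of_sign hk sqr srp
    exact (hasCommonNeighbor_of_frameDist_add_two_le T hk brp bqr drp dqr (by omega)).rotate
  · have fqr := T.frameDist_eq_of_sign hk srp spq
    exact hasCommonNeighbor_of_frameDist_add_two_le T hk bpq brp dpq drp (by omega)
  · have frp := T.frameDist_eq_of_sign hk spq sqr
    exact (hasCommonNeighbor_of_frameDist_add_two_le T hk bqr bpq dqr dpq
      (by omega)).rotate.rotate
  · have fpq := T.frameDist_eq_cycleNorm_add_tailDist hk w p q
    have fqr := T.frameDist_eq_cycleNorm_add_tailDist hk w q r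
    have frp := T.frameDist_eq_cycleNorm_add_tailDist hk w r p
    have fpr := T.frameDist_comm hk w p r
    obtain ⟨l⟩ : Nonempty (Fin m) := inferInstance
    exact hasCommonNeighbor_of_frameDist_le T hk (w := w) (l := l)
      (fun c => wp (fst_eq_of_eq_cell c))
      (fun c => wq (fst_eq_of_eq_cell c))
      (fun c => wr (fst_eq_of_eq_cell c)) (by omega) (by omega) (by omega)

theorem hasCommonNeighbor_of_not_adj [Nontrivial V] [Nontrivial (Fin m)] (hT : T.IsShattered)
    (npq : ¬ (twistedGraph T m k hk).Adj p q) (nqr : ¬ (twistedGraph T m k hk).Adj q r)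
    (nrp : ¬ (twistedGraph T m k hk).Adj r p) :
    HasCommonNeighbor (twistedGraph T m k hk) p q r := by
  by_cases h : p.1 = q.1 ∨ q.1 = r.1 ∨ r.1 = p.1
  · exact hasCommonNeighbor_of_fst_eq T hk h npq nqr nrp
  · obtain ⟨bpq, bqr, brp⟩ : p.1 ≠ q.1 ∧ q.1 ≠ r.1 ∧ r.1 ≠ p.1 := by
      simpa only [not_or] using h
    have lt {x y : TwistedVertex V m k} (b : x.1 ≠ y.1) (n : ¬ (twistedGraph T m k hk).Adj x y) :
        T.twistDist hk x y < 2 * k :=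
      twistDist_lt_of_not_adj T hk (fun c => b (fst_eq_of_eq_cell c)) n
    exact hT.hasCommonNeighbor hk bpq bqr brp (lt bpq npq) (lt bqr nqr) (lt brp nrp)

end CommonNeighbors

section ExtensionProperties

open TwistedVertex

variable {V : Type*} {T : Tournament V} {m k : ℕ} (hk : 1 ≤ k) {p q r : TwistedVertex V m k}

theorem card_le_encard_commonNeighbors {w : V} {l : Fin m}
    (U : Finset (Fin (3 * k - 1) → ZMod 2)) (hU : ∀ u ∈ U,
      (twistedGraph T m k hk).Adj (w, l, u + 1) p ∧ (twistedGraph T m k hk).Adj (w, l, u + 1) q) :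
    (U.card : ℕ∞) ≤ ((twistedGraph T m k hk).commonNeighbors p q).encard := by
  rw [← Set.encard_coe_eq_coe_finsetCard]
  refine Set.encard_le_encard_of_injOn (f := fun u => (w, l, u + 1)) ?_ ?_
  · exact fun u hu => ⟨(hU u hu).1.symm, (hU u hu).2.symm⟩
  · exact fun u _ v _ huv => add_right_cancel (congrArg (fun x => x.2.2) huv)

theorem centralBinom_le_encard_commonNeighbors_of_twistDist_add_two_le [Nontrivial V]
    [Nontrivial (Fin m)] (h : T.twistDist hk p q + 2 ≤ 2 * k) :
    ((k - 1).centralBinom : ℕ∞) ≤ 2 * ((twistedGraph T m k hk).commonNeighbors p q).encard := by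
  obtain ⟨w, l, cp, cq, hw⟩ : ∃ (w : V) (l : Fin m), (w, l) ≠ p.cell ∧ (w, l) ≠ q.cell ∧
      T.frameDist hk w p q = T.twistDist hk p q := by
    obtain ⟨l, hl⟩ := exists_ne p.2.1
    by_cases hi : p.1 = q.1
    · obtain ⟨w, hw⟩ := exists_ne p.1
      exact ⟨w, l, fun c => hw (fst_eq_of_eq_cell c),
        fun c => hw ((fst_eq_of_eq_cell c).trans hi.symm),
        T.frameDist_eq_twistDist hk (Or.inr (Or.inl hi))⟩
    · exact ⟨p.1, l, fun c => hl (snd_eq_of_eq_cell c), fun c => hi (fst_eq_of_eq_cell c), rfl⟩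
  have hball := centralBinom_le_card_hammingDist_le (r := k - 1) (by rw [Fintype.card_fin]; omega)
    (T.frame hk w p) (T.frame hk w q) (by rw [← Tournament.frameDist]; omega)
  refine le_trans (by exact_mod_cast hball) (mul_le_mul_right
    (card_le_encard_commonNeighbors hk (w := w) (l := l) _ fun u hu => ?_) 2)
  obtain ⟨-, hup, huq⟩ := Finset.mem_filter.1 hu
  rw [twistedGraph_adj_add_one_of_cell_ne T hk cp, twistedGraph_adj_add_one_of_cell_ne T hk cq]
  omega

theorem centralBinom_le_encard_commonNeighbors_of_le_twistDist_add_one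
    (hpq : ¬ (twistedGraph T m k hk).Adj p q) (h : 2 * k ≤ T.twistDist hk p q + 1) :
    ((k - 1).centralBinom : ℕ∞) ≤ ((twistedGraph T m k hk).commonNeighbors p q).encard := by
  have centralBinom_le {j : ℕ} (hj : k - 1 ≤ j) : (k - 1).centralBinom ≤ (k + j).choose k := by
    rw [Nat.centralBinom_eq_two_mul_choose]
    calc (2 * (k - 1)).choose (k - 1) ≤ (k - 1 + j).choose (k - 1) :=
          Nat.choose_le_choose _ (by omega)
      _ = (k - 1 + j).choose j := Nat.choose_symm_add
      _ ≤ (k + j).choose j := Nat.choose_le_choose _ (by omega)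
      _ = (k + j).choose k := Nat.choose_symm_add.symm
  by_cases hcell : p.cell = q.cell
  · have hd : T.twistDist hk p q = k + k := by
      rw [twistedGraph_adj_of_cell_eq T hk hcell] at hpq
      omega
    have hgeod := (centralBinom_le (Nat.sub_le k 1)).trans
      (choose_le_card_hammingDist_eq (T.frame hk p.1 p) (T.frame hk p.1 q) hd)
    refine le_trans (by exact_mod_cast hgeod) (card_le_encard_commonNeighbors hk
      (w := p.1) (l := p.2.1) _ fun u hu => ?_)
    obtain ⟨-, hup, huq⟩ := Finset.mem_filter.1 hu
    exact ⟨(twistedGraph_adj_add_one_of_cell_eq T hk rfl).2 (Or.inl hup),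
      (twistedGraph_adj_add_one_of_cell_eq T hk hcell).2 (Or.inl huq)⟩
  · have hd : T.twistDist hk p q = k + (k - 1) := by
      have hlt := twistDist_lt_of_not_adj T hk hcell hpq
      omega
    have hgeod := (centralBinom_le le_rfl).trans
      (choose_le_card_hammingDist_eq (T.frame hk p.1 p) (T.frame hk p.1 q) hd)
    refine le_trans (by exact_mod_cast hgeod) (card_le_encard_commonNeighbors hk
      (w := p.1) (l := p.2.1) _ fun u hu => ?_)
    obtain ⟨-, hup, huq⟩ := Finset.mem_filter.1 hu
    exact ⟨(twistedGraph_adj_add_one_of_cell_eq T hk rfl).2 (Or.inl hup),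
      (twistedGraph_adj_add_one_of_cell_ne T hk hcell).2 (by omega)⟩

theorem centralBinom_le_encard_commonNeighbors [Nontrivial V] [Nontrivial (Fin m)]
    (hpq : ¬ (twistedGraph T m k hk).Adj p q) :
    ((k - 1).centralBinom : ℕ∞) ≤ 2 * ((twistedGraph T m k hk).commonNeighbors p q).encard := by
  by_cases h : T.twistDist hk p q + 2 ≤ 2 * k
  · exact centralBinom_le_encard_commonNeighbors_of_twistDist_add_two_le hk h
  · refine (centralBinom_le_encard_commonNeighbors_of_le_twistDist_add_one hk hpq
      (by omega)).trans ?_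
    rw [two_mul]
    exact le_self_add

theorem exists_notMem_of_card_lt {α : Type*} {n : ℕ} (hα : n < ENat.card α) {s : Finset α}
    (hs : s.card ≤ n) : ∃ x, x ∉ s := by
  by_contra! h
  rw [← Set.encard_univ, ← Set.eq_univ_of_forall (s := (s : Set α)) h,
    Set.encard_coe_eq_coe_finsetCard, Nat.cast_lt] at hα
  exact hα.not_ge hs

theorem exists_not_adj_three [Nonempty (Fin m)] (hV : 3 < ENat.card V)
    (p q r : TwistedVertex V m k) : ∃ v, (v ≠ p ∧ ¬ (twistedGraph T m k hk).Adj v p) ∧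
      (v ≠ q ∧ ¬ (twistedGraph T m k hk).Adj v q) ∧ v ≠ r ∧ ¬ (twistedGraph T m k hk).Adj v r := by
  classical
  obtain ⟨w, hw⟩ := exists_notMem_of_card_lt hV (Finset.card_le_three (a := p.1) (b := q.1)
    (c := r.1))
  obtain ⟨wp, wq, wr⟩ : w ≠ p.1 ∧ w ≠ q.1 ∧ w ≠ r.1 := by
    simpa only [Finset.mem_insert, Finset.mem_singleton, not_or] using hw
  obtain ⟨l⟩ := ‹Nonempty (Fin m)›
  obtain ⟨u, hp, hq, hr⟩ := exists_le_hammingDist (k := k) (by rw [Fintype.card_fin]; omega)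
    (T.frame hk w p) (T.frame hk w q) (T.frame hk w r)
  have far {s : TwistedVertex V m k} (ws : w ≠ s.1) (hs : k ≤ hammingDist u (T.frame hk w s)) :
      (w, l, u + 1) ≠ s ∧ ¬ (twistedGraph T m k hk).Adj (w, l, u + 1) s :=
    ⟨ne_of_apply_ne Prod.fst ws, by
      rwa [twistedGraph_adj_add_one_of_cell_ne T hk fun c => ws (fst_eq_of_eq_cell c), not_lt]⟩
  exact ⟨_, far wp hp, far wq hq, far wr hr⟩

theorem exists_adj_not_adj_two (hk7 : 7 ≤ k) (hpq : p ≠ q) (hpr : p ≠ r) :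
    ∃ v, (twistedGraph T m k hk).Adj v p ∧ (v ≠ q ∧ ¬ (twistedGraph T m k hk).Adj v q) ∧
      v ≠ r ∧ ¬ (twistedGraph T m k hk).Adj v r := by
  have card_eq : Fintype.card (Fin (3 * k - 1)) + 1 = 3 * k := by
    rw [Fintype.card_fin]
    omega
  obtain ⟨u, hup, huq, hur, sepq, sepr⟩ := exists_hammingDist_eq_lt_hammingDist hk7 card_eq
    (T.frame hk p.1 p) (T.frame hk p.1 q) (T.frame hk p.1 r)
  have far {s : TwistedVertex V m k} (hps : p ≠ s) (hs : k ≤ hammingDist u (T.frame hk p.1 s))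
      (sep : T.frame hk p.1 p ≠ T.frame hk p.1 s → k < hammingDist u (T.frame hk p.1 s) ∧
        hammingDist u (T.frame hk p.1 s) < Fintype.card (Fin (3 * k - 1))) :
      (p.1, p.2.1, u + 1) ≠ s ∧ ¬ (twistedGraph T m k hk).Adj (p.1, p.2.1, u + 1) s := by
    by_cases c : p.cell = s.cell
    · have hi : p.1 = s.1 := fst_eq_of_eq_cell c
      have hj : p.2.1 = s.2.1 := snd_eq_of_eq_cell c
      have frame_s : T.frame hk p.1 s = s.2.2 := by rw [hi, T.frame_self]
      rw [T.frame_self, frame_s] at sep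
      obtain ⟨lt_dist, dist_lt⟩ := sep fun hx => hps (Prod.ext hi (Prod.ext hj hx))
      refine ⟨fun hs' => ?_, ?_⟩
      · have dist_s := hammingDist_add_one u s.2.2
        rw [show u + 1 = s.2.2 from congrArg (fun x => x.2.2) hs', hammingDist_self] at dist_s
        omega
      · rw [twistedGraph_adj_add_one_of_cell_eq T hk c, frame_s]
        omega
    · refine ⟨fun hs' => c (hs' ▸ rfl), ?_⟩
      rwa [twistedGraph_adj_add_one_of_cell_ne T hk c, not_lt]
  exact ⟨_, (twistedGraph_adj_add_one_of_cell_eq T hk rfl).2 (Or.inl hup), far hpq huq sepq,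
    far hpr hur sepr⟩

theorem exists_adj_two_not_adj_of_adj [Nontrivial V] [Nontrivial (Fin m)] (hk3 : 3 ≤ k)
    (hpq : ¬ (twistedGraph T m k hk).Adj p q) (hpr : (twistedGraph T m k hk).Adj p r) :
    ∃ v, (twistedGraph T m k hk).Adj v p ∧ (twistedGraph T m k hk).Adj v q ∧
      v ≠ r ∧ ¬ (twistedGraph T m k hk).Adj v r := by
  have two_lt : 2 < (k - 1).centralBinom :=
    Nat.centralBinom_strictMono (show 1 < k - 1 by omega)
  have one_lt : 1 < ((twistedGraph T m k hk).commonNeighbors p q).encard := by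
    by_contra! hle
    have h := (centralBinom_le_encard_commonNeighbors hk hpq).trans (mul_le_mul_right hle 2)
    exact two_lt.not_ge (by exact_mod_cast h)
  obtain ⟨v, ⟨hvp, hvq⟩, hvr⟩ := Set.exists_ne_of_one_lt_encard one_lt r
  exact ⟨v, hvp.symm, hvq.symm, hvr, twistedGraph_not_adj T hk hpr.symm hvp⟩

theorem exists_adj_two_not_adj [Nontrivial V] [Nontrivial (Fin m)] (hT : T.IsShattered)
    (hk7 : 7 ≤ k) (hpq : ¬ (twistedGraph T m k hk).Adj p q) (hrp : r ≠ p) (hrq : r ≠ q) :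
    ∃ v, (twistedGraph T m k hk).Adj v p ∧ (twistedGraph T m k hk).Adj v q ∧
      v ≠ r ∧ ¬ (twistedGraph T m k hk).Adj v r := by
  by_cases apr : (twistedGraph T m k hk).Adj p r
  · exact exists_adj_two_not_adj_of_adj hk (by omega) hpq apr
  by_cases aqr : (twistedGraph T m k hk).Adj q r
  · obtain ⟨v, hvq, hvp, hvr⟩ := exists_adj_two_not_adj_of_adj hk (by omega)
      (fun h => hpq h.symm) aqr
    exact ⟨v, hvp, hvq, hvr⟩
  -- a neighbour of a neighbour `x` of `r` is not adjacent to `r`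
  obtain ⟨x, hxr, ⟨-, hxp⟩, -, hxq⟩ := exists_adj_not_adj_two (T := T) hk hk7 hrp hrq
  obtain ⟨v, hvp, hvq, hvx⟩ := hasCommonNeighbor_of_not_adj hk hT hpq (fun h => hxq h.symm) hxp
  exact ⟨v, hvp, hvq, fun h => apr (h ▸ hvp.symm), fun hvr =>
    twistedGraph_not_adj T hk hvr.symm hvx hxr⟩

theorem isExistentiallyComplete_of_forall_card_eq {W : Type*} {G : SimpleGraph W} {n : ℕ}
    (hW : n ≤ ENat.card W) (h : ∀ B C : Finset W, Disjoint B C → B.card + C.card = n →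
      G.IsIndepSet (B : Set W) → ∃ v, (∀ b ∈ B, G.Adj v b) ∧ ∀ c ∈ C, v ≠ c ∧ ¬ G.Adj v c) :
    IsExistentiallyComplete G n := by
  classical
  intro A B hBA hA hB
  obtain ⟨D, hAD, hD⟩ : ∃ D : Finset W, A ⊆ D ∧ D.card = n := by
    obtain ⟨D, hAD, -, hD⟩ := Set.exists_superset_subset_encard_eq (k := n)
      (Set.subset_univ (A : Set W)) (by rwa [Set.encard_coe_eq_coe_finsetCard, Nat.cast_le])
      (by rwa [Set.encard_univ])
    lift D to Finset W using Set.finite_of_encard_eq_coe hD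
    rw [Set.encard_coe_eq_coe_finsetCard, Nat.cast_inj] at hD
    exact ⟨D, Finset.coe_subset.1 hAD, hD⟩
  have hcard : B.card + (D \ B).card = n := by
    rw [add_comm, Finset.card_sdiff_add_card_eq_card (hBA.trans hAD), hD]
  obtain ⟨v, hvB, hvC⟩ := h B (D \ B) Finset.disjoint_sdiff hcard hB
  have hv {a : W} (ha : a ∈ A) (haB : a ∉ B) : v ≠ a ∧ ¬ G.Adj v a :=
    hvC a (Finset.mem_sdiff.2 ⟨hAD ha, haB⟩)
  refine ⟨v, fun hvA => ?_, hvB, fun a ha haB => (hv ha haB).2⟩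
  by_cases hvB' : v ∈ B
  · exact G.irrefl (hvB v hvB')
  · exact (hv hvA hvB').1 rfl

theorem twistedGraph_isExistentiallyComplete [Nontrivial (Fin m)] (hT : T.IsShattered)
    (hk7 : 7 ≤ k) (hV : 3 < ENat.card V) : IsExistentiallyComplete (twistedGraph T m k hk) 3 := by
  classical
  have : Nontrivial V := (ENat.one_lt_card_iff_nontrivial V).1 (lt_trans (by norm_num) hV)
  obtain ⟨l⟩ : Nonempty (Fin m) := inferInstance
  have card_le : ENat.card V ≤ ENat.card (TwistedVertex V m k) :=
    ENat.card_le_card_of_injective (f := fun i => (i, l, 0)) fun _ _ h => congrArg Prod.fst h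
  refine isExistentiallyComplete_of_forall_card_eq (hV.le.trans card_le)
    fun B C hBC hcard hB => ?_
  obtain h | h | h | h : B.card = 0 ∨ B.card = 1 ∨ B.card = 2 ∨ B.card = 3 := by omega
  · obtain rfl := Finset.card_eq_zero.1 h
    obtain ⟨p, q, r, -, -, -, rfl⟩ := Finset.card_eq_three.1 (show C.card = 3 by omega)
    simpa using exists_not_adj_three hk hV p q r
  · obtain ⟨p, rfl⟩ := Finset.card_eq_one.1 h
    obtain ⟨q, r, -, rfl⟩ := Finset.card_eq_two.1 (show C.card = 2 by omega)
    simp only [Finset.disjoint_singleton_left, Finset.mem_insert, Finset.mem_singleton,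
      not_or] at hBC
    simpa using exists_adj_not_adj_two hk hk7 hBC.1 hBC.2
  · obtain ⟨p, q, hpq, rfl⟩ := Finset.card_eq_two.1 h
    obtain ⟨r, rfl⟩ := Finset.card_eq_one.1 (show C.card = 1 by omega)
    simp only [Finset.disjoint_singleton_right, Finset.mem_insert, Finset.mem_singleton,
      not_or] at hBC
    simpa [and_assoc] using exists_adj_two_not_adj hk hT hk7 (hB (by simp) (by simp) hpq) hBC.1
      hBC.2
  · obtain ⟨p, q, r, hpq, hpr, hqr, rfl⟩ := Finset.card_eq_three.1 h
    obtain rfl := Finset.card_eq_zero.1 (show C.card = 0 by omega)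
    simpa [HasCommonNeighbor] using hasCommonNeighbor_of_not_adj hk hT
      (hB (by simp) (by simp) hpq) (hB (by simp) (by simp) hqr) (hB (by simp) (by simp) hpr.symm)

theorem arc_of_twistedGraph_le [Nonempty (Fin m)] {T' : Tournament V}
    (h : twistedGraph T m k hk ≤ twistedGraph T' m k hk) {i j : V} (hij : T.arc i j) :
    T'.arc i j := by
  by_contra hij'
  have hne : i ≠ j := fun e => T.irrefl j (e ▸ hij)
  have hji : T'.arc j i := (T'.total i j hne).resolve_left hij'
  obtain ⟨l⟩ := ‹Nonempty (Fin m)›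
  let q : TwistedVertex V m k := (j, l, 0)
  have frame_ne : T.frame hk i q ≠ T'.frame hk i q := fun e => by
    have angle_eq := congrArg (cubeAngle (by omega)) e
    simp only [Tournament.frame, cubeAngle_cubeRot, add_right_inj] at angle_eq
    rw [Tournament.sign_of_arc hij, Tournament.sign_of_arc_swap hji] at angle_eq
    exact absurd angle_eq (by decide)
  have cell_ne : (i, l) ≠ q.cell := fun c => hne (fst_eq_of_eq_cell c)
  obtain ⟨u, hu, hu'⟩ := exists_hammingDist_lt_le hk (by rw [Fintype.card_fin]; omega) frame_ne
  exact hu'.not_gt ((twistedGraph_adj_add_one_of_cell_ne T' hk cell_ne).1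
    (h ((twistedGraph_adj_add_one_of_cell_ne T hk cell_ne).2 hu)))

theorem twistedGraph_injective [Nonempty (Fin m)] :
    Function.Injective fun T : Tournament V => twistedGraph T m k hk := by
  intro T T' h
  refine Tournament.arc_injective ?_
  ext i j
  exact ⟨arc_of_twistedGraph_le hk h.le, arc_of_twistedGraph_le hk h.ge⟩

end ExtensionProperties

section Counting

open scoped Finset

variable {V : Type*}

namespace Tournament

variable {T T' : Tournament V} {S D : Finset V} {d : V}

noncomputable instance [Finite V] : Fintype (Tournament V) :=
  @Fintype.ofFinite _ (Finite.of_injective _ arc_injective)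

theorem arc_iff_not_arc_swap (T : Tournament V) {i j : V} (h : i ≠ j) :
    T.arc i j ↔ ¬ T.arc j i :=
  ⟨T.asymm i j, (T.total i j h).resolve_right⟩

/-- The tournament on a linear order in which an edge is oriented upwards if it belongs to the graph
`G` and downwards otherwise. -/
def ofGraph [LinearOrder V] (G : SimpleGraph V) : Tournament V where
  arc i j := i < j ∧ G.Adj i j ∨ j < i ∧ ¬ G.Adj i j
  irrefl i := by simp
  asymm i j := by grind [G.adj_comm i j]
  total i j hij := by grind [G.adj_comm i j]

theorem ofGraph_injective [LinearOrder V] : Function.Injective (ofGraph (V := V)) := by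
  have adj_of_lt {G H : SimpleGraph V} (h : ofGraph G = ofGraph H) {i j : V} (hij : i < j) :
      G.Adj i j ↔ H.Adj i j := by
    have arc_eq : (ofGraph G).arc i j = (ofGraph H).arc i j := by rw [h]
    simpa [ofGraph, hij, hij.not_gt] using arc_eq
  intro G H h
  ext i j
  rcases lt_trichotomy i j with hij | rfl | hij
  · exact adj_of_lt h hij
  · simp
  · rw [G.adj_comm, H.adj_comm, adj_of_lt h hij]

theorem two_pow_choose_two_le_card [Fintype V] :
    2 ^ (Fintype.card V).choose 2 ≤ Fintype.card (Tournament V) := by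
  classical
  let := linearOrderOfSTO (WellOrderingRel (α := V))
  have fromEdgeSet_injOn : Set.InjOn
      (fun E : Finset (Sym2 V) => ofGraph (SimpleGraph.fromEdgeSet (E : Set (Sym2 V))))
      ((⊤ : SimpleGraph V).edgeFinset.powerset : Set (Finset (Sym2 V))) := by
    intro E hE E' hE' h
    have edgeSet_fromEdgeSet {E : Finset (Sym2 V)} (hE : E ⊆ (⊤ : SimpleGraph V).edgeFinset) :
        (SimpleGraph.fromEdgeSet (E : Set (Sym2 V))).edgeSet = E := by
      rw [← Finset.coe_subset, SimpleGraph.coe_edgeFinset, SimpleGraph.edgeSet_top] at hE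
      rw [SimpleGraph.edgeSet_fromEdgeSet, sdiff_eq_left]
      exact Set.disjoint_left.2 fun e he => hE he
    rw [Finset.mem_coe, Finset.mem_powerset] at hE hE'
    rw [← Finset.coe_inj, ← edgeSet_fromEdgeSet hE, ← edgeSet_fromEdgeSet hE',
      ofGraph_injective h]
  have card_le := Finset.card_le_card_of_injOn _ (fun _ _ => Finset.mem_univ _) fromEdgeSet_injOn
  rwa [Finset.card_powerset, SimpleGraph.card_edgeFinset_top_eq_card_choose_two] at card_le

/-- The set `insert d S` carries a copy of `T₄`. -/
def CompletesT4 (T : Tournament V) (S : Finset V) (d : V) : Prop :=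
  ∃ f : Fin 4 → V, Set.range f = insert d ↑S ∧ ∀ u v, T4Arc u v → T.arc (f u) (f v)

theorem t4Arc_total : ∀ u v, u ≠ v → T4Arc u v ∨ T4Arc v u := by decide

theorem forall_t4Arc_imp {P : Fin 4 → Fin 4 → Prop} :
    (∀ u v, T4Arc u v → P u v) ↔ P 0 1 ∧ P 0 2 ∧ P 0 3 ∧ P 1 2 ∧ P 2 3 ∧ P 3 1 := by
  simp [T4Arc, Fin.forall_fin_succ, and_assoc]

theorem injective_of_t4Arc_imp {f : Fin 4 → V} (hf : ∀ u v, T4Arc u v → T.arc (f u) (f v)) :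
    Function.Injective f := by
  intro u v huv
  by_contra hne
  rcases t4Arc_total u v hne with h | h
  · exact T.irrefl (f v) (huv ▸ hf u v h)
  · exact T.irrefl (f v) (huv ▸ hf v u h)

theorem arc_iff_t4Arc_of_imp {f : Fin 4 → V} (hf : ∀ u v, T4Arc u v → T.arc (f u) (f v))
    (u v : Fin 4) : T.arc (f u) (f v) ↔ T4Arc u v := by
  refine ⟨fun h => ?_, hf u v⟩
  have hne : u ≠ v := fun e => T.irrefl (f v) (e ▸ h)
  exact (t4Arc_total u v hne).resolve_right fun hvu => T.asymm _ _ h (hf v u hvu)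

theorem isShattered_of_forall_completesT4
    (h : ∀ S : Finset V, #S = 3 → ∃ d, T.CompletesT4 S d) : T.IsShattered := by
  classical
  intro a b c hab hac hbc
  obtain ⟨d, f, range_f, hf⟩ := h {a, b, c} (Finset.card_eq_three.2 ⟨a, b, c, hab, hac, hbc, rfl⟩)
  refine ⟨⟨f, injective_of_t4Arc_imp hf⟩, ?_, ?_, ?_, Or.inl (arc_iff_t4Arc_of_imp hf)⟩ <;>
    simp [range_f]

theorem CompletesT4.congr (hT : T.CompletesT4 S d)
    (h : ∀ x ∈ insert d (S : Set V), ∀ y ∈ insert d (S : Set V), T.arc x y → T'.arc x y) :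
    T'.CompletesT4 S d := by
  obtain ⟨f, range_f, hf⟩ := hT
  exact ⟨f, range_f, fun u v huv => h _ (range_f ▸ ⟨u, rfl⟩) _ (range_f ▸ ⟨v, rfl⟩) (hf u v huv)⟩

open Classical in
/-- The tournament obtained from `T` by reorienting the edges between `d` and `S`: the
out-neighbours of `d` in `S` become those that satisfy `g`. -/
def reorient (T : Tournament V) (hd : d ∉ S) (g : V → Prop) : Tournament V where
  arc x y := if x = d ∧ y ∈ S then g y else if y = d ∧ x ∈ S then ¬ g x else T.arc x y
  irrefl x := by grind [T.irrefl x]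
  asymm x y := by grind [T.asymm x y]
  total x y hxy := by grind [T.total x y hxy]

theorem reorient_arc_left (hd : d ∉ S) (g : V → Prop) {s : V} (hs : s ∈ S) :
    (T.reorient hd g).arc d s ↔ g s := by
  simp [reorient, hs]

theorem reorient_arc_right (hd : d ∉ S) (g : V → Prop) {s : V} (hs : s ∈ S) :
    (T.reorient hd g).arc s d ↔ ¬ g s := by
  simp [reorient, hs, hd]

theorem reorient_arc_of_not (hd : d ∉ S) (g : V → Prop) {x y : V} (hxy : ¬ (x = d ∧ y ∈ S))
    (hyx : ¬ (y = d ∧ x ∈ S)) : (T.reorient hd g).arc x y ↔ T.arc x y := by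
  simp [reorient, hxy, hyx]

theorem eq_of_reorient_eq {hd : d ∉ S} {g g' : V → Prop}
    (h : T.reorient hd g = T'.reorient hd g') (hS : ∀ s ∈ S, T.arc d s ↔ T'.arc d s) : T = T' := by
  refine arc_injective ?_
  ext x y
  by_cases hxy : x = d ∧ y ∈ S
  · exact hxy.1 ▸ hS y hxy.2
  by_cases hyx : y = d ∧ x ∈ S
  · obtain ⟨rfl, hx⟩ := hyx
    have hne : x ≠ y := fun e => hd (e ▸ hx)
    rw [T.arc_iff_not_arc_swap hne, T'.arc_iff_not_arc_swap hne, hS x hx]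
  · rw [← reorient_arc_of_not hd g hxy hyx, h, reorient_arc_of_not hd g' hxy hyx]

theorem exists_eq_insert_arc_arc [DecidableEq V] (T : Tournament V) (hS : #S = 3) :
    ∃ x y z, S = {x, y, z} ∧ T.arc x y ∧ T.arc y z := by
  obtain ⟨a, b, c, hab, hac, hbc, rfl⟩ := Finset.card_eq_three.1 hS
  have hbac : ({a, b, c} : Finset V) = {b, a, c} := Finset.insert_comm a b {c}
  grind [T.total a b hab, T.total a c hac, T.total b c hbc]

theorem exists_reorient_completesT4 (T : Tournament V) (hS : #S = 3) (hd : d ∉ S) :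
    ∃ g, (T.reorient hd g).CompletesT4 S d := by
  classical
  obtain ⟨x, y, z, rfl, hxy, hyz⟩ := T.exists_eq_insert_arc_arc hS
  have hxz : x ≠ z := fun e => T.asymm _ _ hxy (e ▸ hyz)
  have hne {i j : V} (h : T.arc i j) : i ≠ j := fun e => T.irrefl j (e ▸ h)
  have arc_of_arc {g : V → Prop} {i j : V} (hi : i ≠ d) (hj : j ≠ d) (h : T.arc i j) :
      (T.reorient hd g).arc i j :=
    (reorient_arc_of_not hd g (fun e => hi e.1) fun e => hj e.1).2 h
  have hxd : x ≠ d := by grind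
  have hyd : y ≠ d := by grind
  have hzd : z ≠ d := by grind
  rcases T.total x z hxz with hxz | hzx
  · refine ⟨(· = y), ![x, y, z, d], ?_, forall_t4Arc_imp.2 ⟨arc_of_arc hxd hyd hxy,
      arc_of_arc hxd hzd hxz, (reorient_arc_right hd _ (by simp)).2 (hne hxy),
      arc_of_arc hyd hzd hyz, (reorient_arc_right hd _ (by simp)).2 (hne hyz).symm,
      (reorient_arc_left hd _ (by simp)).2 rfl⟩⟩
    simp only [Matrix.range_cons, Matrix.range_empty]
    grind
  · refine ⟨fun _ => True, ![d, x, y, z], ?_, forall_t4Arc_imp.2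
      ⟨(reorient_arc_left hd _ (by simp)).2 trivial, (reorient_arc_left hd _ (by simp)).2 trivial,
        (reorient_arc_left hd _ (by simp)).2 trivial, arc_of_arc hxd hyd hxy,
        arc_of_arc hyd hzd hyz, arc_of_arc hzd hxd hzx⟩⟩
    simp only [Matrix.range_cons, Matrix.range_empty]
    grind

open Classical in
theorem card_forall_not_completesT4_le [Finite V] (hS : #S = 3) (hd : d ∉ S) (hdD : d ∉ D) :
    #{T : Tournament V | ∀ x ∈ D, ¬ T.CompletesT4 S x} ≤
      8 * #{T : Tournament V | (∀ x ∈ D, ¬ T.CompletesT4 S x) ∧ T.CompletesT4 S d} := by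
  choose g hg using fun T : Tournament V => T.exists_reorient_completesT4 hS hd
  have card_prop : Fintype.card (S → Prop) = 8 := by simp [hS]
  rw [← card_prop, ← Finset.card_univ, ← Finset.card_product]
  refine Finset.card_le_card_of_injOn
    (fun T => (fun s : S => T.arc d s, T.reorient hd (g T))) (fun T hT => ?_) fun T _ T' _ h => ?_
  · simp only [Finset.coe_filter, Finset.mem_univ, true_and, Set.mem_ofPred_eq] at hT
    simp only [Finset.coe_product, Finset.coe_univ, Finset.coe_filter, Finset.mem_univ, true_and,
      Set.mem_prod, Set.mem_univ, Set.mem_ofPred_eq]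
    refine ⟨fun x hx hc => hT x hx (hc.congr fun a ha b hb => ?_), hg T⟩
    have ne_of_mem {i : V} (hi : i ∈ insert x (S : Set V)) : i ≠ d := by grind
    exact (reorient_arc_of_not hd _ (fun e => ne_of_mem ha e.1) fun e => ne_of_mem hb e.1).1
  · obtain ⟨h_out, h_reorient⟩ := Prod.mk.inj h
    exact eq_of_reorient_eq h_reorient fun s hs => iff_of_eq (congrFun h_out ⟨s, hs⟩)

open Classical in
theorem eight_pow_mul_card_forall_not_completesT4_le [Finite V] (hS : #S = 3)
    (hDS : Disjoint D S) :
    8 ^ #D * #{T : Tournament V | ∀ x ∈ D, ¬ T.CompletesT4 S x} ≤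
      7 ^ #D * Fintype.card (Tournament V) := by
  induction D using Finset.induction_on with
  | empty => simp
  | insert d D hdD ih =>
    rw [Finset.disjoint_insert_left] at hDS
    have le_eight_mul := card_forall_not_completesT4_le hS hDS.1 hdD
    have card_add := Finset.card_filter_add_card_filter_not
      (s := {T : Tournament V | ∀ x ∈ D, ¬ T.CompletesT4 S x}) fun T => T.CompletesT4 S d
    simp only [Finset.filter_filter] at card_add
    simp only [Finset.forall_mem_insert, and_comm (a := ¬ CompletesT4 _ S d)]
    rw [Finset.card_insert_of_notMem hdD]
    have ih := ih hDS.2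
    set all := #{T : Tournament V | ∀ x ∈ D, ¬ T.CompletesT4 S x}
    set bad := #{T : Tournament V | (∀ x ∈ D, ¬ T.CompletesT4 S x) ∧ ¬ T.CompletesT4 S d}
    calc 8 ^ (#D + 1) * bad = 8 ^ #D * (8 * bad) := by ring
      _ ≤ 8 ^ #D * (7 * all) := Nat.mul_le_mul_left _ (by omega)
      _ = 7 * (8 ^ #D * all) := by ring
      _ ≤ 7 * (7 ^ #D * Fintype.card (Tournament V)) := Nat.mul_le_mul_left _ ih
      _ = 7 ^ (#D + 1) * Fintype.card (Tournament V) := by ring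

open Classical in
theorem eight_pow_mul_card_not_isShattered_le [Fintype V] :
    8 ^ (Fintype.card V - 3) * #{T : Tournament V | ¬ T.IsShattered} ≤
      (Fintype.card V).choose 3 * (7 ^ (Fintype.card V - 3) * Fintype.card (Tournament V)) := by
  have subset_biUnion : ({T | ¬ T.IsShattered} : Finset (Tournament V)) ⊆
      (Finset.univ.powersetCard 3).biUnion fun S : Finset V =>
        {T | ∀ x ∈ Sᶜ, ¬ T.CompletesT4 S x} := by
    intro T hT
    rw [Finset.mem_filter_univ] at hT
    obtain ⟨S, hS, h⟩ : ∃ S : Finset V, #S = 3 ∧ ∀ d, ¬ T.CompletesT4 S d := by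
      simpa using mt isShattered_of_forall_completesT4 hT
    exact Finset.mem_biUnion.2 ⟨S, by simpa using hS, by simpa using fun x _ => h x⟩
  calc 8 ^ (Fintype.card V - 3) * #{T : Tournament V | ¬ T.IsShattered}
      ≤ 8 ^ (Fintype.card V - 3) * ∑ S ∈ Finset.univ.powersetCard 3,
          #{T : Tournament V | ∀ x ∈ Sᶜ, ¬ T.CompletesT4 S x} :=
        Nat.mul_le_mul_left _ ((Finset.card_le_card subset_biUnion).trans Finset.card_biUnion_le)
    _ ≤ #(Finset.univ.powersetCard 3 : Finset (Finset V)) •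
          (7 ^ (Fintype.card V - 3) * Fintype.card (Tournament V)) := by
        rw [Finset.mul_sum]
        refine Finset.sum_le_card_nsmul _ _ _ fun S hS => ?_
        have hS := (Finset.mem_powersetCard.1 hS).2
        simpa [Finset.card_compl, hS] using
          eight_pow_mul_card_forall_not_completesT4_le hS disjoint_compl_left
    _ = (Fintype.card V).choose 3 * (7 ^ (Fintype.card V - 3) * Fintype.card (Tournament V)) := by
        rw [Finset.card_powersetCard, Finset.card_univ, smul_eq_mul]

end Tournament

theorem eventually_two_mul_choose_three_mul_seven_pow_le : ∀ᶠ t : ℕ in Filter.atTop,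
    2 * (t.choose 3 * 7 ^ (t - 3)) ≤ 8 ^ (t - 3) := by
  have tendsto_zero := tendsto_pow_const_mul_const_pow_of_lt_one 3 (r := (7 / 8 : ℝ)) (by norm_num)
    (by norm_num)
  filter_upwards [tendsto_zero.eventually_lt_const (show (0 : ℝ) < (7 / 8) ^ 3 / 2 by norm_num),
    Filter.eventually_ge_atTop 3] with t ht ht3
  obtain ⟨s, rfl⟩ := Nat.exists_eq_add_of_le' ht3
  have choose_le : (((s + 3).choose 3 : ℕ) : ℝ) ≤ ((s + 3 : ℕ) : ℝ) ^ 3 := by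
    exact_mod_cast Nat.choose_le_pow (s + 3) 3
  have real_bound : (2 * ((s + 3).choose 3 * 7 ^ s) : ℝ) ≤ 8 ^ s := by
    rw [div_pow, div_pow, pow_add, pow_add] at ht
    field_simp at ht
    calc (2 * ((s + 3).choose 3 * 7 ^ s) : ℝ) = (s + 3).choose 3 * 7 ^ s * 2 := by ring
      _ ≤ ((s + 3 : ℕ) : ℝ) ^ 3 * 7 ^ s * 2 := by gcongr
      _ ≤ 8 ^ s := ht.le
  rw [Nat.add_sub_cancel]
  exact_mod_cast real_bound

open Classical in
theorem eventually_two_pow_choose_two_le_two_mul_card_isShattered : ∀ᶠ t : ℕ in Filter.atTop,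
    2 ^ t.choose 2 ≤ 2 * #{T : Tournament (Fin t) | T.IsShattered} := by
  filter_upwards [eventually_two_mul_choose_three_mul_seven_pow_le] with t ht
  have card_ge := Tournament.two_pow_choose_two_le_card (V := Fin t)
  have card_not := Tournament.eight_pow_mul_card_not_isShattered_le (V := Fin t)
  have card_add := Finset.card_filter_add_card_filter_not (s := Finset.univ)
    fun T : Tournament (Fin t) => T.IsShattered
  rw [Finset.card_univ] at card_add
  rw [Fintype.card_fin] at card_ge card_not
  have two_mul_card_not_le : 2 * #{T : Tournament (Fin t) | ¬ T.IsShattered} ≤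
      Fintype.card (Tournament (Fin t)) := by
    refine Nat.le_of_mul_le_mul_left (c := 8 ^ (t - 3)) ?_ (by positivity)
    calc 8 ^ (t - 3) * (2 * #{T : Tournament (Fin t) | ¬ T.IsShattered})
        = 2 * (8 ^ (t - 3) * #{T : Tournament (Fin t) | ¬ T.IsShattered}) := by ring
      _ ≤ 2 * (t.choose 3 * (7 ^ (t - 3) * Fintype.card (Tournament (Fin t)))) :=
          Nat.mul_le_mul_left _ card_not
      _ = 2 * (t.choose 3 * 7 ^ (t - 3)) * Fintype.card (Tournament (Fin t)) := by ring
      _ ≤ 8 ^ (t - 3) * Fintype.card (Tournament (Fin t)) := Nat.mul_le_mul_right _ ht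
  omega

end Counting

section Isomorphism

open scoped Finset

variable {W W' : Type*} {G : SimpleGraph W} {H : SimpleGraph W'}

theorem IsExistentiallyComplete.of_iso {n : ℕ} (φ : H ≃g G) (hG : IsExistentiallyComplete G n) :
    IsExistentiallyComplete H n := by
  intro A B hBA hA hB
  have map_indep : G.IsIndepSet (B.map φ.toEquiv.toEmbedding : Set W) := by
    rw [Finset.coe_map]
    exact Set.Pairwise.image fun a ha b hb hab h => hB ha hb hab (φ.map_adj_iff.1 h)
  obtain ⟨v, hvA, hvB, hv⟩ := hG _ _ (Finset.map_subset_map.2 hBA) ((A.card_map _).trans_le hA)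
    map_indep
  obtain ⟨v, rfl⟩ := φ.surjective v
  refine ⟨v, fun h => hvA (Finset.mem_map_of_mem φ.toEquiv.toEmbedding h), fun b hb => ?_,
    fun a ha haB hva => ?_⟩
  · exact φ.map_adj_iff.1 (hvB (φ b) (Finset.mem_map_of_mem φ.toEquiv.toEmbedding hb))
  · exact hv (φ a) (Finset.mem_map_of_mem φ.toEquiv.toEmbedding ha)
      (fun h => haB ((Finset.mem_map' φ.toEquiv.toEmbedding).1 h)) (φ.map_adj_iff.2 hva)

theorem Is3ECTF.of_iso (φ : H ≃g G) (hG : Is3ECTF G) : Is3ECTF H := by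
  obtain ⟨hfin, hfree, hec⟩ := hG
  exact ⟨Finite.of_equiv W φ.symm.toEquiv, hfree.comap ⟨φ.toEmbedding.toCopy⟩, hec.of_iso φ⟩

theorem encard_commonNeighbors_of_iso (φ : H ≃g G) (x y : W') :
    (G.commonNeighbors (φ x) (φ y)).encard = (H.commonNeighbors x y).encard := by
  have preimage_eq : H.commonNeighbors x y = φ ⁻¹' G.commonNeighbors (φ x) (φ y) := by
    ext v
    exact (and_congr φ.map_adj_iff φ.map_adj_iff).symm
  rw [preimage_eq, Set.encard_preimage_of_bijective φ.bijective]

open Classical in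
theorem exists_subset_pairwise_isEmpty_iso [Fintype W] (X : Finset (SimpleGraph W)) :
    ∃ S ⊆ X, (∀ G ∈ S, ∀ H ∈ S, G ≠ H → IsEmpty (G ≃g H)) ∧
      #X ≤ (Fintype.card W).factorial * #S := by
  let isoSetoid : Setoid (SimpleGraph W) :=
    ⟨fun G H => Nonempty (G ≃g H), fun _ => ⟨.refl⟩, fun ⟨φ⟩ => ⟨φ.symm⟩,
      fun ⟨φ⟩ ⟨ψ⟩ => ⟨φ.trans ψ⟩⟩
  obtain ⟨S, hSX, hinj, himage⟩ := Finset.exists_subset_injOn_image_eq_of_surjOn (X : Set _)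
    (X.image (Quotient.mk isoSetoid)) (by simpa using Set.surjOn_image _ _)
  refine ⟨S, hSX, fun G hG H hH hne => ⟨fun φ => hne (hinj hG hH (Quotient.sound ⟨φ⟩))⟩, ?_⟩
  have subset_image : X ⊆ Finset.image₂ (fun (σ : Equiv.Perm W) H => H.comap σ) Finset.univ S := by
    intro G hG
    obtain ⟨H, hH, hHG⟩ := Finset.mem_image.1 (himage ▸ Finset.mem_image_of_mem _ hG)
    obtain ⟨φ⟩ : Nonempty (G ≃g H) := Quotient.exact hHG.symm
    exact Finset.mem_image₂.2 ⟨φ.toEquiv, Finset.mem_univ _, H, hH, by ext; exact φ.map_adj_iff⟩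
  calc #X ≤ #(Finset.univ : Finset (Equiv.Perm W)) * #S :=
        (Finset.card_le_card subset_image).trans (Finset.card_image₂_le _ _ _)
    _ = (Fintype.card W).factorial * #S := by rw [Finset.card_univ, Fintype.card_perm]

end Isomorphism

section Asymptotics

open scoped Finset

variable {V : Type*} {m k : ℕ} (hk : 1 ≤ k)

theorem twistedGraph_is3ECTF [Finite V] [Nontrivial (Fin m)] {T : Tournament V}
    (hT : T.IsShattered) (hk7 : 7 ≤ k) (hV : 3 < Nat.card V) : Is3ECTF (twistedGraph T m k hk) :=
  ⟨inferInstance, twistedGraph_cliqueFree_three T hk,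
    twistedGraph_isExistentiallyComplete hk hT hk7 (by simpa [ENat.card_eq_coe_natCard] using hV)⟩

theorem card_twistedVertex [Fintype V] :
    Fintype.card (TwistedVertex V m k) = Fintype.card V * (m * 2 ^ (3 * k - 1)) := by
  simp [TwistedVertex, ZMod.card]

open Classical in
theorem exists_pairwise_isEmpty_iso_twistedGraph [Fintype V] [Nonempty (Fin m)] :
    ∃ S : Finset (SimpleGraph (Fin (Fintype.card (TwistedVertex V m k)))),
      #{T : Tournament V | T.IsShattered} ≤ (Fintype.card (TwistedVertex V m k)).factorial * #S ∧
      (∀ G ∈ S, ∀ H ∈ S, G ≠ H → IsEmpty (G ≃g H)) ∧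
      ∀ G ∈ S, ∃ T : Tournament V, T.IsShattered ∧ Nonempty (G ≃g twistedGraph T m k hk) := by
  let e := (Fintype.equivFin (TwistedVertex V m k)).symm
  have comap_injective : Function.Injective fun T : Tournament V =>
      (twistedGraph T m k hk).comap e :=
    e.symm.simpleGraph.injective.comp (twistedGraph_injective hk)
  obtain ⟨S, hSX, hS, hcard⟩ := exists_subset_pairwise_isEmpty_iso
    (Finset.image (fun T => (twistedGraph T m k hk).comap e) {T : Tournament V | T.IsShattered})
  rw [Finset.card_image_of_injective _ comap_injective, Fintype.card_fin] at hcard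
  refine ⟨S, hcard, hS, fun G hG => ?_⟩
  obtain ⟨T, hT, rfl⟩ := Finset.mem_image.1 (hSX hG)
  exact ⟨T, (Finset.mem_filter.1 hT).2, ⟨.comap e _⟩⟩

theorem eventually_factorial_le_two_rpow {ε : ℝ} (hε : 0 < ε) :
    ∀ᶠ n : ℕ in Filter.atTop, (n.factorial : ℝ) ≤ 2 ^ (ε * (n : ℝ) ^ 2) := by
  have hlog2 : 0 < Real.log 2 := Real.log_pos one_lt_two
  filter_upwards [tendsto_natCast_atTop_atTop.eventually
      (Real.isLittleO_log_id_atTop.bound (mul_pos hε hlog2)), Filter.eventually_ge_atTop 1]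
    with n hlog hn
  have hn0 : (0 : ℝ) < n := by exact_mod_cast hn
  have log_le : Real.log n ≤ ε * Real.log 2 * n := by
    simpa using (le_abs_self _).trans hlog
  have pow_le : (n : ℝ) ^ n ≤ 2 ^ (ε * (n : ℝ) ^ 2) := by
    rw [← Real.log_le_log_iff (by positivity) (by positivity), Real.log_pow,
      Real.log_rpow two_pos]
    calc n * Real.log n ≤ n * (ε * Real.log 2 * n) := mul_le_mul_of_nonneg_left log_le hn0.le
      _ = ε * (n : ℝ) ^ 2 * Real.log 2 := by ring
  exact le_trans (by exact_mod_cast n.factorial_le_pow) pow_le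

theorem two_mul_two_rpow_mul_two_rpow_le {A n t : ℕ} (ht : 4 ≤ t) (hnt : n < (t + 1) * A) :
    (2 : ℝ) * (2 ^ (1 / (64 * (A : ℝ) ^ 2) * (n : ℝ) ^ 2) *
      2 ^ (1 / (64 * (A : ℝ) ^ 2) * (n : ℝ) ^ 2)) ≤ 2 ^ t.choose 2 := by
  have hA : (0 : ℝ) < A := by
    exact_mod_cast Nat.pos_of_ne_zero fun h => by simp [h] at hnt
  have ht' : (4 : ℝ) ≤ t := by exact_mod_cast ht
  have n_le : (n : ℝ) ≤ 2 * (A * t) := by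
    have : (n : ℝ) < (t + 1) * A := by exact_mod_cast hnt
    nlinarith
  have exponent_le : 1 / (64 * (A : ℝ) ^ 2) * (n : ℝ) ^ 2 ≤ (t : ℝ) ^ 2 / 16 := by
    calc 1 / (64 * (A : ℝ) ^ 2) * (n : ℝ) ^ 2 ≤ 1 / (64 * (A : ℝ) ^ 2) * (2 * (A * t)) ^ 2 := by
          gcongr
      _ = (t : ℝ) ^ 2 / 16 := by field_simp; norm_num
  calc (2 : ℝ) * (2 ^ (1 / (64 * (A : ℝ) ^ 2) * (n : ℝ) ^ 2) *
        2 ^ (1 / (64 * (A : ℝ) ^ 2) * (n : ℝ) ^ 2))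
      ≤ 2 * (2 ^ ((t : ℝ) ^ 2 / 16) * 2 ^ ((t : ℝ) ^ 2 / 16)) := by gcongr <;> norm_num
    _ = 2 ^ (1 + ((t : ℝ) ^ 2 / 16 + (t : ℝ) ^ 2 / 16)) := by
        rw [Real.rpow_add two_pos, Real.rpow_add two_pos, Real.rpow_one]
    _ ≤ 2 ^ ((t.choose 2 : ℕ) : ℝ) := by
        refine Real.rpow_le_rpow_of_exponent_le one_le_two ?_
        rw [Nat.cast_choose_two]
        nlinarith
    _ = 2 ^ t.choose 2 := Real.rpow_natCast _ _

theorem eventually_exists_pairwise_isEmpty_iso_twistedGraph [Nonempty (Fin m)] :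
    ∀ᶠ n : ℕ in Filter.atTop, ∃ S : Finset (Σ v : ℕ, SimpleGraph (Fin v)),
      (2 : ℝ) ^ (1 / (64 * ((m * 2 ^ (3 * k - 1) : ℕ) : ℝ) ^ 2) * (n : ℝ) ^ 2) ≤ #S ∧
      (∀ G ∈ S, ∀ H ∈ S, G ≠ H → IsEmpty (G.2 ≃g H.2)) ∧
      ∀ G ∈ S, G.1 ≤ n ∧ ∃ (t : ℕ) (T : Tournament (Fin t)), 4 ≤ t ∧ T.IsShattered ∧
        Nonempty (G.2 ≃g twistedGraph T m k hk) := by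
  classical
  set A := m * 2 ^ (3 * k - 1) with hA_def
  have hA : 0 < A := Nat.mul_pos (Fin.pos_iff_nonempty.2 ‹_›) (by positivity)
  have tendsto_div : Filter.Tendsto (fun n : ℕ => n / A) Filter.atTop Filter.atTop :=
    Nat.tendsto_div_const_atTop hA.ne'
  filter_upwards [tendsto_div.eventually (Filter.eventually_ge_atTop 4),
    tendsto_div.eventually eventually_two_pow_choose_two_le_two_mul_card_isShattered,
    eventually_factorial_le_two_rpow (show 0 < 1 / (64 * (A : ℝ) ^ 2) by positivity)]
    with n ht card_shattered factorial_le
  set t := n / A with ht_def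
  have card_le : Fintype.card (TwistedVertex (Fin t) m k) ≤ n := by
    rw [card_twistedVertex, Fintype.card_fin]
    exact Nat.div_mul_le_self n A
  obtain ⟨S, card_S, hS, hST⟩ := exists_pairwise_isEmpty_iso_twistedGraph (V := Fin t) (m := m) hk
  refine ⟨S.map ⟨Sigma.mk _, sigma_mk_injective⟩, ?_, ?_, ?_⟩
  · rw [Finset.card_map]
    have card_bound : (2 : ℝ) ^ t.choose 2 ≤ 2 * (n.factorial * #S) := by
      exact_mod_cast card_shattered.trans (Nat.mul_le_mul_left 2
        (card_S.trans (Nat.mul_le_mul_right _ (Nat.factorial_le card_le))))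
    have lt_mul : n < (t + 1) * A := (Nat.div_lt_iff_lt_mul hA).1 t.lt_succ_self
    set N : ℝ := 2 ^ (1 / (64 * (A : ℝ) ^ 2) * (n : ℝ) ^ 2)
    have hN : 0 < N := by positivity
    refine le_of_mul_le_mul_left ?_ (show 0 < 2 * N by positivity)
    calc 2 * N * N = 2 * (N * N) := mul_assoc 2 N N
      _ ≤ 2 ^ t.choose 2 := two_mul_two_rpow_mul_two_rpow_le ht lt_mul
      _ ≤ 2 * (n.factorial * #S) := card_bound
      _ ≤ 2 * (N * #S) := by gcongr
      _ = 2 * N * #S := (mul_assoc 2 N _).symm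
  · intro G hG H hH hne
    obtain ⟨G, hGS, rfl⟩ := Finset.mem_map.1 hG
    obtain ⟨H, hHS, rfl⟩ := Finset.mem_map.1 hH
    exact hS G hGS H hHS fun e => hne (e ▸ rfl)
  · intro G hG
    obtain ⟨G, hGS, rfl⟩ := Finset.mem_map.1 hG
    obtain ⟨T, hT, hφ⟩ := hST G hGS
    exact ⟨card_le, t, T, ht, hT, hφ⟩

theorem four_pow_le_mul_log {M i : ℕ} (hM : 2 ≤ M) (hi : 0 < i) (h : i.centralBinom < 2 * M) :
    (4 : ℝ) ^ i ≤ 20 * (M * Real.log M) := by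
  have hM' : (2 : ℝ) ≤ M := by exact_mod_cast hM
  have four_pow_le : (4 : ℝ) ^ i ≤ 4 * i * M := by
    calc (4 : ℝ) ^ i ≤ 2 * i * i.centralBinom := by
          exact_mod_cast Nat.four_pow_le_two_mul_self_mul_centralBinom i hi
      _ ≤ 2 * i * (2 * M) := by
          gcongr
          exact_mod_cast h.le
      _ = 4 * i * M := by ring
  have two_pow_le : (2 : ℝ) ^ i ≤ 4 * M := by
    have hi2 : (i : ℝ) ≤ 2 ^ i := by exact_mod_cast i.lt_two_pow_self.le
    refine le_of_mul_le_mul_right ?_ (show (0 : ℝ) < 2 ^ i by positivity)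
    calc (2 : ℝ) ^ i * 2 ^ i = 4 ^ i := by rw [← mul_pow]; norm_num
      _ ≤ 4 * i * M := four_pow_le
      _ ≤ 4 * 2 ^ i * M := by gcongr
      _ = 4 * M * 2 ^ i := by ring
  have mul_log_two_le : i * Real.log 2 ≤ 3 * Real.log M := by
    have four_mul_le : 4 * (M : ℝ) ≤ M ^ 3 := by
      calc 4 * (M : ℝ) = 2 ^ 2 * M := by norm_num
        _ ≤ M ^ 2 * M := by gcongr
        _ = M ^ 3 := by ring
    have log_le := Real.log_le_log (by positivity) (two_pow_le.trans four_mul_le)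
    simpa only [Real.log_pow, Nat.cast_ofNat] using log_le
  have i_le : (i : ℝ) ≤ 5 * Real.log M := by
    nlinarith [Real.log_two_gt_d9, i.cast_nonneg (α := ℝ)]
  calc (4 : ℝ) ^ i ≤ 4 * i * M := four_pow_le
    _ ≤ 4 * (5 * Real.log M) * M := by gcongr
    _ = 20 * (M * Real.log M) := by ring

theorem exists_le_centralBinom_and_four_pow_le {M : ℕ} (hM : 2 ≤ M) :
    ∃ k, 7 ≤ k ∧ 2 * M ≤ (k - 1).centralBinom ∧ (4 : ℝ) ^ k ≤ 4 ^ 7 * (M * Real.log M) := by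
  classical
  have exists_le : ∃ j : ℕ, 2 * M ≤ j.centralBinom :=
    ⟨2 * M, Nat.centralBinom_strictMono.le_apply⟩
  rcases le_or_gt (Nat.find exists_le) 6 with hj | hj
  · refine ⟨7, le_rfl, (Nat.find_spec exists_le).trans
      (Nat.centralBinom_strictMono.monotone hj), ?_⟩
    have hM' : (2 : ℝ) ≤ M := by exact_mod_cast hM
    have log_two_le := Real.log_le_log two_pos hM'
    nlinarith [Real.log_two_gt_d9]
  · obtain ⟨i, hi⟩ := Nat.exists_eq_add_of_lt hj
    refine ⟨Nat.find exists_le + 1, by omega, by simpa using Nat.find_spec exists_le, ?_⟩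
    have lt_two_mul : (6 + i).centralBinom < 2 * M :=
      not_le.1 (Nat.find_min exists_le (by omega))
    have := four_pow_le_mul_log hM (by omega) lt_two_mul
    rw [hi, pow_succ, pow_succ]
    linarith [show (0 : ℝ) < 4 ^ (6 + i) by positivity]

theorem le_ncard_commonNeighbors_of_iso_twistedGraph [Finite V] [Nontrivial V]
    [Nontrivial (Fin m)] {T : Tournament V} {W : Type*} {G : SimpleGraph W} {μ : ℕ}
    (φ : G ≃g twistedGraph T m k hk) (hμ : 2 * μ ≤ (k - 1).centralBinom) {x y : W}
    (hxy : ¬ G.Adj x y) : μ ≤ (G.commonNeighbors x y).ncard := by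
  have : Finite W := Finite.of_equiv _ φ.symm.toEquiv
  have card_ge := centralBinom_le_encard_commonNeighbors (T := T) hk
    (fun h => hxy (φ.map_adj_iff.1 h) : ¬ (twistedGraph T m k hk).Adj (φ x) (φ y))
  rw [encard_commonNeighbors_of_iso φ, ← (Set.toFinite _).cast_ncard_eq] at card_ge
  norm_cast at card_ge
  omega

theorem mul_sq_div_pow_three_le (hk : 1 ≤ k) {c L : ℝ} (hc : 0 < c) (h : (4 : ℝ) ^ k ≤ c * L)
    (x : ℝ) :
    1 / (64 * c ^ 3) * x ^ 2 / L ^ 3 ≤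
      1 / (64 * ((2 * 2 ^ (3 * k - 1) : ℕ) : ℝ) ^ 2) * x ^ 2 := by
  have hL : 0 < L := pos_of_mul_pos_right (lt_of_lt_of_le (by positivity) h) hc.le
  have sq_eq : ((2 * 2 ^ (3 * k - 1) : ℕ) : ℝ) ^ 2 = (4 ^ k) ^ 3 := by
    rw [← pow_succ', Nat.sub_add_cancel (by omega)]
    push_cast
    rw [← pow_mul, ← pow_mul, mul_comm, pow_mul, mul_comm k 3]
    norm_num
  calc 1 / (64 * c ^ 3) * x ^ 2 / L ^ 3 = 1 / (64 * (c * L) ^ 3) * x ^ 2 := by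
        rw [mul_pow]
        field_simp
    _ ≤ 1 / (64 * (4 ^ k) ^ 3) * x ^ 2 := by gcongr
    _ = 1 / (64 * ((2 * 2 ^ (3 * k - 1) : ℕ) : ℝ) ^ 2) * x ^ 2 := by rw [sq_eq]

end Asymptotics

theorem mainTheorem6 :
    ∃ c : ℝ, 0 < c ∧ ∀ μ : ℕ, ∃ (k : ℕ) (hk : 1 ≤ k) (n₀ : ℕ), ∀ n : ℕ, n₀ ≤ n →
      ∃ S : Finset (Σ v : ℕ, SimpleGraph (Fin v)),
        (2 : ℝ) ^ (c * (n : ℝ) ^ 2 /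
          (((max μ 2 : ℕ) : ℝ) * Real.log ((max μ 2 : ℕ) : ℝ)) ^ 3) ≤ (S.card : ℝ) ∧
        (∀ G ∈ S, ∀ H ∈ S, G ≠ H → IsEmpty (G.2 ≃g H.2)) ∧
        ∀ G ∈ S, G.1 ≤ n ∧ Is3ECTF G.2 ∧
          (∀ x y, x ≠ y → ¬ G.2.Adj x y → μ ≤ (G.2.commonNeighbors x y).ncard) ∧
          ∃ (t : ℕ) (T : Tournament (Fin t)), T.IsShattered ∧
            Nonempty (G.2 ≃g twistedGraph T 2 k hk) := by
  refine ⟨1 / (64 * (4 ^ 7) ^ 3), by positivity, fun μ => ?_⟩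
  obtain ⟨k, hk7, hkM, four_pow_le⟩ :=
    exists_le_centralBinom_and_four_pow_le (le_max_right μ 2)
  have hk : 1 ≤ k := by omega
  obtain ⟨n₀, hn₀⟩ := Filter.eventually_atTop.1
    (eventually_exists_pairwise_isEmpty_iso_twistedGraph (m := 2) hk)
  refine ⟨k, hk, n₀, fun n hn => ?_⟩
  obtain ⟨S, hcard, hS, hST⟩ := hn₀ n hn
  refine ⟨S, (Real.rpow_le_rpow_of_exponent_le one_le_two ?_).trans hcard, hS, fun G hG => ?_⟩
  · exact mul_sq_div_pow_three_le hk (by positivity) four_pow_le n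
  · obtain ⟨hGn, t, T, ht, hT, ⟨φ⟩⟩ := hST G hG
    have : Nontrivial (Fin t) := Fin.nontrivial_iff_two_le.2 (by omega)
    have hμ : 2 * μ ≤ (k - 1).centralBinom := by omega
    exact ⟨hGn, (twistedGraph_is3ECTF hk hT hk7 (by rw [Nat.card_fin]; omega)).of_iso φ,
      fun _ _ _ hxy => le_ncard_commonNeighbors_of_iso_twistedGraph hk φ hμ hxy, t, T, hT, ⟨φ⟩⟩
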